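/- Let $a\vee 0=\max\{a,0\}$, $a\wedge 0=\min\{a,0\}$, and for step sizes $\Delta x,\Delta t>0$ let $D_\pm$ denote the forward/backward difference quotients in space (step $\Delta x$) and $D_+^t$ the forward difference quotient in time (step $\Delta t$). Put $x_j=j\Delta x$, $x_{j+1/2}=(j+\frac12)\Delta x$ ($j\in\mathbb Z$), $t^n=n\Delta t$ ($0\le n\le N$, $N\Delta t=T$). For $u_0\in H^1(\mathbb R)$, $u_0\ne0$ (identified with its continuous representative), consider the explicit scheme for the Camassa--Holm equation $$u^0_{j+1/2}=u_0(x_{j+1/2}),\qquad D_+^tu^n_{j+1/2}+(u^n_{j+1/2}\vee0)D_-u^n_{j+1/2}+(u^n_{j+1/2}\wedge0)D_+u^n_{j+1/2}+D_+P^n_j=0\quad(0\le n<N),$$ where $(P^n_j)_{j\in\mathbb Z}$, $0\le n\le N$, is the bounded solution of $$-D_-D_+P^n_j+P^n_j=(u^n_{j+1/2}\vee0)^2+(u^n_{j-1/2}\wedge0)^2+\tfrac12\big(D_-u^n_{j+1/2}\big)^2 .$$ Let $q^n_j=D_-u^n_{j+1/2}$ and let $q_{\Delta x}(t,x)=q^n_j+(t-t^n)D_+^tq^n_j$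 for $t\in[t^n,t^{n+1})$, $x\in[x_{j-1/2},x_{j+1/2})$. There is an absolute constant $K>0$ such that the following holds for all such $u_0$ and all $T>0$. For every $\theta>0$ there is $\delta>0$, depending only on $u_0$, $T$ and $\theta$, and for all $a<b$ and $0<\alpha<1$ there is a constant $C=C(a,b,T,\alpha)$ (depending also on the fixed initial datum $u_0$), such that for every $\theta>\alpha$, every $0<\Delta x<\delta$ and every $\Delta t=T/N$ satisfying the CFL condition $$\Delta t<\frac{\log(1+\Delta x^\theta)\,\Delta x^2}{K\,\|u_0\|_{H^1(\mathbb R)}^2\,(1+\Delta x^2)}$$ one has $$\int_0^T\int_a^b|q_{\Delta x}(t,x)|^{2+\alpha}\,dx\,dt\le C .$$ In particular $C$ is independent of $\Delta x$ and $\Delta t$. The admissible exponents are thus $\alpha\in(0,\min\{1,\theta\})$. -/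

import Mathlib

open MeasureTheory
open scoped ContDiff

namespace CamassaHolm

noncomputable section

/-- `u ∈ H¹(ℝ)`, given by its continuous representative `u` and its weak derivative `u'`. -/
structure IsH1 (u u' : ℝ → ℝ) : Prop where
  continuous : Continuous u
  memLp : MemLp u 2 volume
  memLp_deriv : MemLp u' 2 volume
  weakDeriv : ∀ φ : ℝ → ℝ, ContDiff ℝ ∞ φ → HasCompactSupport φ →
    ∫ x, u x * deriv φ x = -∫ x, u' x * φ x

/-- The `H¹(ℝ)` norm of a function `u` with weak derivative `u'`. -/
def h1Norm (u u' : ℝ → ℝ) : ℝ :=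
  Real.sqrt ((∫ x, u x ^ 2) + ∫ x, u' x ^ 2)

/-- Forward difference in space. -/
def Dp (dx : ℝ) (v : ℤ → ℝ) (j : ℤ) : ℝ := (v (j + 1) - v j) / dx

/-- Backward difference in space. -/
def Dm (dx : ℝ) (v : ℤ → ℝ) (j : ℤ) : ℝ := (v j - v (j - 1)) / dx

/-- Forward difference in time. -/
def Dt (dt : ℝ) (v : ℕ → ℤ → ℝ) (n : ℕ) (j : ℤ) : ℝ := (v (n + 1) j - v n j) / dt

/-- The explicit difference scheme on the time levels `0, …, N`. The value `u n j` stands for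
`u` at time level `n` and at the half-integer node `x_{j+1/2} = (j + 1/2) dx`, and `P n j` for
`P` at time level `n` and at the node `x_j = j dx`. The bounded solution `P n` of the linear
difference equation is the one given by the decaying discrete Green's function; all other
solutions grow exponentially. -/
structure IsScheme (u₀ : ℝ → ℝ) (dx dt : ℝ) (N : ℕ) (u P : ℕ → ℤ → ℝ) : Prop where
  init : ∀ j : ℤ, u 0 j = u₀ (((j : ℝ) + 1 / 2) * dx)
  step : ∀ n < N, ∀ j : ℤ,
    Dt dt u n j + max (u n j) 0 * Dm dx (u n) j + min (u n j) 0 * Dp dx (u n) j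
      + Dp dx (P n) j = 0
  elliptic : ∀ n ≤ N, ∀ j : ℤ,
    -Dm dx (Dp dx (P n)) j + P n j
      = max (u n j) 0 ^ 2 + min (u n (j - 1)) 0 ^ 2 + 1 / 2 * Dm dx (u n) j ^ 2
  bounded : ∀ n ≤ N, ∃ B : ℝ, ∀ j : ℤ, |P n j| ≤ B

/-- `q_j^n = D₋ u_{j+1/2}^n`. -/
def q (dx : ℝ) (u : ℕ → ℤ → ℝ) (n : ℕ) (j : ℤ) : ℝ := Dm dx (u n) j

/-- The interpolant `q_Δx(t, x)`: affine in time on `[t^n, t^{n+1})` and constant in space on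
the cell `[x_{j-1/2}, x_{j+1/2})`, where `n = ⌊t/dt⌋` and `j = ⌊x/dx + 1/2⌋`. -/
def qInterp (dx dt : ℝ) (u : ℕ → ℤ → ℝ) (t x : ℝ) : ℝ :=
  q dx u ⌊t / dt⌋₊ ⌊x / dx + 1 / 2⌋
    + (t - (⌊t / dt⌋₊ : ℝ) * dt) * Dt dt (q dx u) ⌊t / dt⌋₊ ⌊x / dx + 1 / 2⌋

/-- The value of the interpolant on the space-time cell with indices `n`, `j`. -/
theorem qInterp_eq {dx dt : ℝ} (hdx : 0 < dx) (hdt : 0 < dt) (u : ℕ → ℤ → ℝ)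
    {n : ℕ} {j : ℤ} {t x : ℝ}
    (ht : t ∈ Set.Ico ((n : ℝ) * dt) (((n : ℝ) + 1) * dt))
    (hx : x ∈ Set.Ico (((j : ℝ) - 1 / 2) * dx) (((j : ℝ) + 1 / 2) * dx)) :
    qInterp dx dt u t x = q dx u n j + (t - (n : ℝ) * dt) * Dt dt (q dx u) n j := by
  have hn : ⌊t / dt⌋₊ = n := by
    rw [Nat.floor_eq_iff (div_nonneg (le_trans (by positivity) ht.1) hdt.le)]
    exact ⟨(le_div_iff₀ hdt).2 ht.1, (div_lt_iff₀ hdt).2 ht.2⟩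
  have hj : ⌊x / dx + 1 / 2⌋ = j := by
    rw [Int.floor_eq_iff]
    have h1 := (le_div_iff₀ hdx).2 hx.1
    have h2 := (div_lt_iff₀ hdx).2 hx.2
    constructor <;> linarith
  simp only [qInterp, hn, hj]

/-- The CFL type condition with constant `K` and exponent `θ`, where `M` is the `H¹` norm of
the initial datum. -/
def CFL (K θ M dx dt : ℝ) : Prop :=
  dt < Real.log (1 + dx ^ θ) * dx ^ 2 / (K * M ^ 2 * (1 + dx ^ 2))

end

end CamassaHolm

/-!
Write `q = D₋u`, `p = max u 0`, `m = min u 0`, and let `E` be the discrete `H¹` energy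
`dx ∑ (u² + q²)`. Differencing the scheme and removing `D₋D₊P` with the elliptic equation gives a
Riccati type equation for `q` (`IsLevel.Dm_velocity`):
`D₊ᵗq + p_{j-1} D₋q + m_j D₊q + q²/2 + P - p_j² - m_{j-1}² = 0`.

*Energy.* Testing with `u` and `q`, all cubic terms cancel up to a discrete divergence and only the
dissipation of the upwind differences remains (`IsLevel.local_energy_balance`). An Euler step adds
an error of size `dt² (1 + dx⁻²) E²` (`IsLevel.energy_step`). Under the CFL condition, for `dx`
small depending on `θ` and `T`, these errors add up to at most the bound `3 ‖u₀‖²` for the initial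
energy, so both the energy and the total dissipation stay bounded
(`IsScheme.isLevel_and_energy_le`). This needs bounds for `P` in terms of `E`. They follow from
boundedness of `P` alone: the minimum principle gives `P ≥ 0`, the telescoping partial sums give
`P ∈ ℓ¹`, and summation of the differences gives the pointwise bounds. It also needs the initial
energy, which is controlled because the continuous representative of `u₀` has increments
bounded by integrals of `|u₀'|` (`IsH1.abs_sub_le`, by mollified indicators as test functions).

*Higher integrability.* For `f(q) = q (1 + q²)^(α/2)`, a discrete chain rule turns the equation for
`q` into a balance for `f(q)` whose source is `q f(q) - q² f'(q) / 2 ≥ (1 - α)/2 |q|^(2+α)`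
(`renorm_coercive`). As `f''` is bounded, the Taylor remainders of `f` in space and in time are
dominated by the dissipation and by the error `dt² dx ∑ (D₊ᵗq)²`, which are already under control,
and all other terms grow at most quadratically in `q`. Localizing with a cut-off and summing over
space-time bounds `∑ dt dx |q|^(2+α)` over the levels `n < N` (`IsScheme.sum_levelSum_le`); at
`n = N` the CFL condition suffices (`IsScheme.dt_mul_levelSum_le`). The interpolant is, in each
cell, a convex combination of two consecutive levels, so its integral is bounded by such sums.
-/

namespace CamassaHolm

/-! ### Summable sequences on the integers -/

theorem summable_shift_add {f : ℤ → ℝ} (hf : Summable f) (m : ℤ) :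
    Summable fun j => f (j + m) :=
  (Equiv.addRight m).summable_iff.2 hf

theorem summable_shift_sub {f : ℤ → ℝ} (hf : Summable f) (m : ℤ) :
    Summable fun j => f (j - m) :=
  (Equiv.subRight m).summable_iff.2 hf

theorem tsum_shift_add (f : ℤ → ℝ) (m : ℤ) : ∑' j, f (j + m) = ∑' j, f j :=
  (Equiv.addRight m).tsum_eq f

theorem tsum_shift_sub (f : ℤ → ℝ) (m : ℤ) : ∑' j, f (j - m) = ∑' j, f j :=
  (Equiv.subRight m).tsum_eq f

/-- A discrete divergence sums to zero: this is how every summation by parts is carried out. -/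
theorem tsum_sub_shift {G : ℤ → ℝ} (hG : Summable G) : ∑' j, (G j - G (j - 1)) = 0 := by
  rw [hG.tsum_sub (summable_shift_sub hG 1), tsum_shift_sub, sub_self]

theorem summable_of_abs_le {f g : ℤ → ℝ} (hf : Summable f) (h : ∀ j, |g j| ≤ f j) :
    Summable g :=
  Summable.of_norm_bounded hf h

/-- A sequence on `ℤ` that vanishes at infinity is bounded by its total variation. -/
theorem abs_le_tsum_of_abs_sub_le {g d : ℤ → ℝ} (hg : Filter.Tendsto g Filter.cofinite (nhds 0))
    (hd : Summable d) (h : ∀ j, |g j - g (j - 1)| ≤ d j) (j : ℤ) : |g j| ≤ ∑' i, d i := by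
  have hd0 : ∀ i, 0 ≤ d i := fun i => (abs_nonneg _).trans (h i)
  have hinj : Function.Injective fun n : ℕ => j - (n : ℤ) := fun a b hab => by
    simpa using hab
  have key : ∀ n : ℕ, |g j| ≤ |g (j - n)| + ∑ i ∈ Finset.range n, d (j - i) := by
    intro n
    induction n with
    | zero => simp
    | succ n ih =>
      rw [Finset.sum_range_succ]
      have h1 := h (j - n)
      have h2 : |g (j - n)| ≤ |g (j - n) - g (j - n - 1)| + |g (j - n - 1)| := by
        simpa using abs_add_le (g (j - n) - g (j - n - 1)) (g (j - n - 1))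
      have h3 : j - ((n + 1 : ℕ) : ℤ) = j - n - 1 := by push_cast; ring
      rw [h3]
      linarith
  have hlim : Filter.Tendsto (fun n : ℕ => |g (j - n)| + ∑' i, d i) Filter.atTop
      (nhds (|0| + ∑' i, d i)) := by
    refine ((hg.comp ?_).abs).add_const _
    rw [← Nat.cofinite_eq_atTop]
    exact hinj.tendsto_cofinite
  rw [abs_zero, zero_add] at hlim
  refine ge_of_tendsto' hlim fun n => (key n).trans ?_
  gcongr
  have h4 : ∑ i ∈ Finset.range n, d (j - i)
      = ∑ i ∈ (Finset.range n).map ⟨fun n : ℕ => j - (n : ℤ), hinj⟩, d i := by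
    rw [Finset.sum_map]; rfl
  rw [h4]
  exact hd.sum_le_tsum _ fun i _ => hd0 i

/-! ### The discrete elliptic equation -/

section Elliptic

variable {dx : ℝ} {P f : ℤ → ℝ}

theorem sub_eq_of_elliptic (hdx : 0 < dx) (hP : ∀ j, -Dm dx (Dp dx P) j + P j = f j) (j : ℤ) :
    (P (j + 1) - P j) - (P j - P (j - 1)) = dx ^ 2 * (P j - f j) := by
  rw [← hP j]
  simp only [Dm, Dp, sub_add_cancel]
  field_simp
  ring

/-- Minimum principle: a bounded solution with nonnegative right-hand side is nonnegative. -/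
theorem elliptic_nonneg (hdx : 0 < dx) (hP : ∀ j, -Dm dx (Dp dx P) j + P j = f j)
    (hf : ∀ j, 0 ≤ f j) {B : ℝ} (hB : ∀ j, |P j| ≤ B) (j : ℤ) : 0 ≤ P j := by
  have hbdd : BddBelow (Set.range P) := ⟨-B, by
    rintro _ ⟨i, rfl⟩; exact (abs_le.1 (hB i)).1⟩
  have h2 : 2 / (2 + dx ^ 2) * (⨅ i, P i) ≤ ⨅ i, P i := by
    refine le_ciInf fun i => ?_
    have h3 := sub_eq_of_elliptic hdx hP i
    have h4 := ciInf_le hbdd (i + 1)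
    have h5 := ciInf_le hbdd (i - 1)
    have h6 := hf i
    rw [div_mul_eq_mul_div, div_le_iff₀ (by positivity)]
    nlinarith [mul_nonneg (sq_nonneg dx) h6]
  rw [div_mul_eq_mul_div, div_le_iff₀ (by positivity)] at h2
  have h7 : 0 ≤ dx ^ 2 * ⨅ i, P i := by linarith
  exact (nonneg_of_mul_nonneg_right h7 (by positivity)).trans (ciInf_le hbdd j)

/-- The partial sums of `P - f` telescope to differences of `P`, so boundedness of `P` alone
makes its partial sums bounded. -/
theorem elliptic_summable (hdx : 0 < dx) (hP : ∀ j, -Dm dx (Dp dx P) j + P j = f j)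
    (hf : ∀ j, 0 ≤ f j) (hfs : Summable f) {B : ℝ} (hB : ∀ j, |P j| ≤ B) : Summable P := by
  have h0 := elliptic_nonneg hdx hP hf hB
  have hsub := sub_eq_of_elliptic hdx hP
  have hsum : ∀ (m : ℤ) (n : ℕ), dx ^ 2 * ∑ i ∈ Finset.range n, P (m + i)
      = dx ^ 2 * ∑ i ∈ Finset.range n, f (m + i)
        + ((P (m + n) - P (m + n - 1)) - (P m - P (m - 1))) := by
    intro m n
    induction n with
    | zero => simp
    | succ n ih =>
      rw [Finset.sum_range_succ, Finset.sum_range_succ, mul_add, ih]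
      have h3 := hsub (m + n)
      have h4 : m + ((n + 1 : ℕ) : ℤ) = m + n + 1 := by push_cast; ring
      rw [h4, add_sub_cancel_right]
      linarith
  have hinj : ∀ m : ℤ, Function.Injective fun n : ℕ => m + (n : ℤ) := fun m a b hab => by
    simpa using hab
  have hbd : ∀ (m : ℤ) (n : ℕ), ∑ i ∈ Finset.range n, P (m + i)
      ≤ (dx ^ 2 * ∑' j, f j + 4 * B) / dx ^ 2 := by
    intro m n
    rw [le_div_iff₀ (by positivity), mul_comm, hsum m n]
    have h5 : ∑ i ∈ Finset.range n, f (m + i) ≤ ∑' j, f j := by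
      have h4 : ∑ i ∈ Finset.range n, f (m + i)
          = ∑ i ∈ (Finset.range n).map ⟨fun n : ℕ => m + (n : ℤ), hinj m⟩, f i := by
        rw [Finset.sum_map]; rfl
      rw [h4]
      exact hfs.sum_le_tsum _ fun i _ => hf i
    have h6 := mul_le_mul_of_nonneg_left h5 (sq_nonneg dx)
    have a1 := abs_le.1 (hB (m + n))
    have a2 := abs_le.1 (hB (m + n - 1))
    have a3 := abs_le.1 (hB m)
    have a4 := abs_le.1 (hB (m - 1))
    linarith
  refine summable_of_sum_le h0 (c := (dx ^ 2 * ∑' j, f j + 4 * B) / dx ^ 2) fun s => ?_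
  obtain ⟨R, hR⟩ : ∃ R : ℕ, ∀ i ∈ s, i.natAbs ≤ R :=
    ⟨s.sup Int.natAbs, fun i hi => Finset.le_sup (f := Int.natAbs) hi⟩
  refine le_trans ?_ (hbd (-(R : ℤ)) (2 * R + 1))
  have h4 : ∑ i ∈ Finset.range (2 * R + 1), P (-(R : ℤ) + i)
      = ∑ i ∈ (Finset.range (2 * R + 1)).map ⟨fun n : ℕ => -(R : ℤ) + (n : ℤ), hinj _⟩, P i := by
    rw [Finset.sum_map]; rfl
  rw [h4]
  refine Finset.sum_le_sum_of_subset_of_nonneg (fun i hi => ?_) fun i _ _ => h0 i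
  have := hR i hi
  simp only [Finset.mem_map, Finset.mem_range, Function.Embedding.coeFn_mk]
  exact ⟨(i + R).toNat, by omega, by omega⟩

theorem elliptic_tsum (hdx : 0 < dx) (hP : ∀ j, -Dm dx (Dp dx P) j + P j = f j)
    (hfs : Summable f) (hPs : Summable P) : ∑' j, P j = ∑' j, f j := by
  have hG : Summable fun j => P (j + 1) - P j := (summable_shift_add hPs 1).sub hPs
  have h1 := tsum_sub_shift hG
  simp only [sub_add_cancel, sub_eq_of_elliptic hdx hP] at h1
  rw [tsum_mul_left, hPs.tsum_sub hfs] at h1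
  have h2 : (dx ^ 2 : ℝ) ≠ 0 := by positivity
  rcases mul_eq_zero.1 h1 with h | h
  · exact absurd h h2
  · linarith

/-- `D₊P` is a partial sum of `D₋D₊P = P - f`, whose two parts have equal mass. -/
theorem abs_Dp_le_of_elliptic (hdx : 0 < dx) (hP : ∀ j, -Dm dx (Dp dx P) j + P j = f j)
    (hf : ∀ j, 0 ≤ f j) (hfs : Summable f) (hP0 : ∀ j, 0 ≤ P j) (hPs : Summable P) (j : ℤ) :
    |Dp dx P j| ≤ 2 * (dx * ∑' i, f i) := by
  have hG : Summable fun j => P (j + 1) - P j := (summable_shift_add hPs 1).sub hPs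
  have h1 : Summable fun j => dx ^ 2 * (P j + f j) := (hPs.add hfs).mul_left _
  have h2 := abs_le_tsum_of_abs_sub_le hG.tendsto_cofinite_zero h1 (fun i => by
    simp only [sub_add_cancel]
    rw [sub_eq_of_elliptic hdx hP, abs_mul, abs_of_nonneg (sq_nonneg dx)]
    have a1 := hP0 i
    have a2 := hf i
    gcongr
    exact abs_le.2 ⟨by linarith, by linarith⟩) j
  rw [tsum_mul_left, hPs.tsum_add hfs, elliptic_tsum hdx hP hfs hPs] at h2
  rw [Dp, abs_div, abs_of_pos hdx, div_le_iff₀ hdx]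
  linarith

/-- The total variation of `P ^ 2` is controlled by the bound on `D₊P` and the mass of `P`. -/
theorem le_of_elliptic (hdx : 0 < dx) (hP : ∀ j, -Dm dx (Dp dx P) j + P j = f j)
    (hf : ∀ j, 0 ≤ f j) (hfs : Summable f) (hP0 : ∀ j, 0 ≤ P j) (hPs : Summable P) (j : ℤ) :
    P j ≤ 2 * (dx * ∑' i, f i) := by
  set F := dx * ∑' i, f i with hF
  have hF0 : 0 ≤ F := mul_nonneg hdx.le (tsum_nonneg hf)
  have h1 : Summable fun j => 2 * F * dx * (P j + P (j - 1)) :=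
    (hPs.add (summable_shift_sub hPs 1)).mul_left _
  have ht : Filter.Tendsto (fun j => P j ^ 2) Filter.cofinite (nhds 0) := by
    simpa using hPs.tendsto_cofinite_zero.pow 2
  have h2 := abs_le_tsum_of_abs_sub_le ht h1 (fun i => by
    have a1 := hP0 i
    have a2 := hP0 (i - 1)
    have a3 := abs_Dp_le_of_elliptic hdx hP hf hfs hP0 hPs (i - 1)
    rw [Dp, abs_div, abs_of_pos hdx, div_le_iff₀ hdx, sub_add_cancel] at a3
    have e : P i ^ 2 - P (i - 1) ^ 2 = (P i - P (i - 1)) * (P i + P (i - 1)) := by ring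
    rw [e, abs_mul, abs_of_nonneg (by linarith : 0 ≤ P i + P (i - 1))]
    gcongr) j
  rw [tsum_mul_left, hPs.tsum_add (summable_shift_sub hPs 1), tsum_shift_sub,
    elliptic_tsum hdx hP hfs hPs, abs_of_nonneg (sq_nonneg _)] at h2
  refine abs_le_of_sq_le_sq' ?_ (by positivity) |>.2
  rw [hF] at *
  nlinarith

theorem summable_sq_Dp {P : ℤ → ℝ} (hPs : Summable fun j => P j ^ 2) :
    Summable fun j => Dp dx P j ^ 2 := by
  refine summable_of_abs_le (((summable_shift_add hPs 1).add hPs).mul_left (2 / dx ^ 2))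
    fun j => ?_
  rw [abs_of_nonneg (sq_nonneg _), Dp, div_pow, div_mul_eq_mul_div]
  gcongr
  nlinarith [sq_nonneg (P (j + 1) + P j)]

theorem summable_sq_of_le {P : ℤ → ℝ} (hPs : Summable P) (hP0 : ∀ j, 0 ≤ P j) {c : ℝ}
    (hc : ∀ j, P j ≤ c) : Summable fun j => P j ^ 2 :=
  summable_of_abs_le (hPs.mul_left c) fun j => by
    rw [abs_of_nonneg (sq_nonneg _), sq]
    exact mul_le_mul_of_nonneg_right (hc j) (hP0 j)

/-- Testing the equation with `P` itself bounds the gradient in `ℓ²`. -/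
theorem tsum_sq_Dp_le_of_elliptic (hdx : 0 < dx) (hP : ∀ j, -Dm dx (Dp dx P) j + P j = f j)
    (hf : ∀ j, 0 ≤ f j) (hfs : Summable f) (hP0 : ∀ j, 0 ≤ P j) (hPs : Summable P) :
    dx * ∑' j, Dp dx P j ^ 2 ≤ 2 * (dx * ∑' i, f i) ^ 2 := by
  set F := dx * ∑' i, f i with hF
  have hF0 : 0 ≤ F := mul_nonneg hdx.le (tsum_nonneg hf)
  have hle : ∀ j, P j ≤ 2 * F := le_of_elliptic hdx hP hf hfs hP0 hPs
  have hsq := summable_sq_of_le hPs hP0 hle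
  have hD : Summable fun j => Dp dx P j ^ 2 := summable_sq_Dp hsq
  have hG : Summable fun j => P j * Dp dx P j := by
    refine summable_of_abs_le (hsq.add hD) fun j => ?_
    rw [abs_mul]
    nlinarith [sq_abs (P j), sq_abs (Dp dx P j), sq_nonneg (|P j| - |Dp dx P j|),
      abs_nonneg (P j), abs_nonneg (Dp dx P j)]
  have hfP : Summable fun j => P j * f j :=
    summable_of_abs_le (hfs.mul_left (2 * F)) fun j => by
      rw [abs_of_nonneg (mul_nonneg (hP0 j) (hf j))]
      exact mul_le_mul_of_nonneg_right (hle j) (hf j)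
  have hD' := summable_shift_sub hD 1
  have e : ∀ j, P j * Dp dx P j - P (j - 1) * Dp dx P (j - 1)
      = dx * (P j ^ 2 - P j * f j + Dp dx P (j - 1) ^ 2) := by
    intro j
    have h := sub_eq_of_elliptic hdx hP j
    simp only [Dp, sub_add_cancel]
    field_simp
    linear_combination P j * h
  have h1 := tsum_sub_shift hG
  simp only [e] at h1
  rw [tsum_mul_left, (hsq.sub hfP).tsum_add hD', tsum_shift_sub (fun j => Dp dx P j ^ 2),
    hsq.tsum_sub hfP] at h1
  have h2 := (mul_eq_zero.1 h1).resolve_left hdx.ne'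
  have h3 : 0 ≤ ∑' j, P j ^ 2 := tsum_nonneg fun j => sq_nonneg _
  have h4 : ∑' j, P j * f j ≤ ∑' j, 2 * F * f j :=
    hfP.tsum_le_tsum (fun j => mul_le_mul_of_nonneg_right (hle j) (hf j)) (hfs.mul_left _)
  rw [tsum_mul_left] at h4
  have h5 : ∑' j, Dp dx P j ^ 2 ≤ 2 * F * ∑' j, f j := by linarith
  calc dx * ∑' j, Dp dx P j ^ 2 ≤ dx * (2 * F * ∑' j, f j) := by gcongr
    _ = 2 * F ^ 2 := by rw [hF]; ring

end Elliptic

/-! ### Energy balance over one time step -/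

/-- The square of the discrete `H¹` norm. -/
noncomputable def energy (dx : ℝ) (u : ℤ → ℝ) : ℝ := dx * ∑' j, (u j ^ 2 + Dm dx u j ^ 2)

/-- The right-hand side of the discrete elliptic equation. -/
noncomputable def source (dx : ℝ) (u : ℤ → ℝ) (j : ℤ) : ℝ :=
  max (u j) 0 ^ 2 + min (u (j - 1)) 0 ^ 2 + 1 / 2 * Dm dx u j ^ 2

/-- The discrete time derivative of `u` that the scheme prescribes. -/
noncomputable def velocity (dx : ℝ) (u P : ℤ → ℝ) (j : ℤ) : ℝ :=
  -(max (u j) 0 * Dm dx u j + min (u j) 0 * Dp dx u j + Dp dx P j)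

/-- The dissipation density of the upwind differences, acting on `q = D₋u`. -/
noncomputable def viscosity (dx : ℝ) (u : ℤ → ℝ) (j : ℤ) : ℝ :=
  max (u (j - 1)) 0 * Dm dx (Dm dx u) j ^ 2 - min (u j) 0 * Dp dx (Dm dx u) j ^ 2

/-- The data `u`, `P` of one time level, with `u` of finite energy. -/
structure IsLevel (dx : ℝ) (u P : ℤ → ℝ) : Prop where
  pos : 0 < dx
  summable : Summable fun j => u j ^ 2 + Dm dx u j ^ 2
  elliptic : ∀ j, -Dm dx (Dp dx P) j + P j = source dx u j
  bounded : ∃ B : ℝ, ∀ j, |P j| ≤ B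

section Parts

variable {dx : ℝ} {u : ℤ → ℝ}

theorem summable_sq (hu : Summable fun j => u j ^ 2 + Dm dx u j ^ 2) :
    Summable fun j => u j ^ 2 :=
  summable_of_abs_le hu fun j => by rw [abs_of_nonneg (sq_nonneg _)]; linarith [sq_nonneg (Dm dx u j)]

theorem summable_sq_Dm (hu : Summable fun j => u j ^ 2 + Dm dx u j ^ 2) :
    Summable fun j => Dm dx u j ^ 2 :=
  summable_of_abs_le hu fun j => by rw [abs_of_nonneg (sq_nonneg _)]; linarith [sq_nonneg (u j)]

theorem energy_eq (hu : Summable fun j => u j ^ 2 + Dm dx u j ^ 2) :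
    energy dx u = dx * ∑' j, u j ^ 2 + dx * ∑' j, Dm dx u j ^ 2 := by
  rw [energy, (summable_sq hu).tsum_add (summable_sq_Dm hu), mul_add]

theorem energy_nonneg (hdx : 0 < dx) : 0 ≤ energy dx u :=
  mul_nonneg hdx.le (tsum_nonneg fun _ => by positivity)

/-- Discrete Sobolev inequality. -/
theorem sq_le_two_energy (hdx : 0 < dx) (hu : Summable fun j => u j ^ 2 + Dm dx u j ^ 2) (j : ℤ) :
    u j ^ 2 ≤ 2 * energy dx u := by
  have h1 := summable_sq hu
  have h2 := summable_sq_Dm hu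
  have h3 := (h2.mul_left (1 / 2)).add (h1.add (summable_shift_sub h1 1))
  have h := abs_le_tsum_of_abs_sub_le h1.tendsto_cofinite_zero (h3.mul_left dx) (fun i => by
    have e : u i ^ 2 - u (i - 1) ^ 2 = dx * (Dm dx u i * (u i + u (i - 1))) := by
      rw [Dm]; field_simp; ring
    rw [e, abs_mul, abs_of_pos hdx]
    gcongr
    refine abs_le.2 ⟨?_, ?_⟩ <;>
    nlinarith [sq_nonneg (Dm dx u i - (u i + u (i - 1))), sq_nonneg (Dm dx u i + (u i + u (i - 1))),
      sq_nonneg (u i - u (i - 1))]) j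
  rw [tsum_mul_left, (h2.mul_left (1 / 2)).tsum_add (h1.add (summable_shift_sub h1 1)),
    h1.tsum_add (summable_shift_sub h1 1), tsum_shift_sub (fun j => u j ^ 2), tsum_mul_left,
    abs_of_nonneg (sq_nonneg _)] at h
  rw [energy_eq hu]
  have : 0 ≤ dx * ∑' j, Dm dx u j ^ 2 := mul_nonneg hdx.le (tsum_nonneg fun _ => sq_nonneg _)
  linarith

theorem max_sq_add_min_sq (x : ℝ) : max x 0 ^ 2 + min x 0 ^ 2 = x ^ 2 := by
  rcases le_total x 0 with h | h <;> simp [h]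

theorem max_sq_le (x : ℝ) : max x 0 ^ 2 ≤ x ^ 2 := by
  linarith [max_sq_add_min_sq x, sq_nonneg (min x 0)]

theorem min_sq_le (x : ℝ) : min x 0 ^ 2 ≤ x ^ 2 := by
  linarith [max_sq_add_min_sq x, sq_nonneg (max x 0)]

theorem source_nonneg (j : ℤ) : 0 ≤ source dx u j := by unfold source; positivity

theorem summable_max_sq (hu : Summable fun j => u j ^ 2) : Summable fun j => max (u j) 0 ^ 2 :=
  summable_of_abs_le hu fun j => by rw [abs_of_nonneg (sq_nonneg _)]; exact max_sq_le _

theorem summable_min_sq (hu : Summable fun j => u j ^ 2) : Summable fun j => min (u j) 0 ^ 2 :=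
  summable_of_abs_le hu fun j => by rw [abs_of_nonneg (sq_nonneg _)]; exact min_sq_le _

theorem summable_source (hu : Summable fun j => u j ^ 2 + Dm dx u j ^ 2) :
    Summable (source dx u) :=
  ((summable_max_sq (summable_sq hu)).add
    (summable_shift_sub (summable_min_sq (summable_sq hu)) 1)).add
    ((summable_sq_Dm hu).mul_left _)

theorem tsum_source_le (hdx : 0 < dx) (hu : Summable fun j => u j ^ 2 + Dm dx u j ^ 2) :
    dx * ∑' j, source dx u j ≤ energy dx u := by
  have h1 := summable_max_sq (summable_sq hu)
  have h2 := summable_min_sq (summable_sq hu)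
  have h3 := summable_shift_sub h2 1
  have e : ∑' j, source dx u j = ∑' j, u j ^ 2 + 1 / 2 * ∑' j, Dm dx u j ^ 2 := by
    simp only [source]
    rw [(h1.add h3).tsum_add ((summable_sq_Dm hu).mul_left _), h1.tsum_add h3,
      tsum_shift_sub (fun j => min (u j) 0 ^ 2), tsum_mul_left, ← h1.tsum_add h2]
    simp only [max_sq_add_min_sq]
  rw [e, energy_eq hu]
  have : 0 ≤ dx * ∑' j, Dm dx u j ^ 2 := mul_nonneg hdx.le (tsum_nonneg fun _ => sq_nonneg _)
  linarith

end Parts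

namespace IsLevel

variable {dx : ℝ} {u P : ℤ → ℝ}

theorem nonneg (h : IsLevel dx u P) (j : ℤ) : 0 ≤ P j :=
  let ⟨_, hB⟩ := h.bounded
  elliptic_nonneg h.pos h.elliptic source_nonneg hB j

theorem summable_P (h : IsLevel dx u P) : Summable P :=
  let ⟨_, hB⟩ := h.bounded
  elliptic_summable h.pos h.elliptic source_nonneg (summable_source h.summable) hB

theorem P_le (h : IsLevel dx u P) (j : ℤ) : P j ≤ 2 * energy dx u :=
  (le_of_elliptic h.pos h.elliptic source_nonneg (summable_source h.summable) h.nonneg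
    h.summable_P j).trans (by linarith [tsum_source_le h.pos h.summable])

theorem summable_sq_P (h : IsLevel dx u P) : Summable fun j => P j ^ 2 :=
  summable_sq_of_le h.summable_P h.nonneg h.P_le

theorem tsum_sq_Dp_P_le (h : IsLevel dx u P) :
    dx * ∑' j, Dp dx P j ^ 2 ≤ 2 * energy dx u ^ 2 := by
  refine (tsum_sq_Dp_le_of_elliptic h.pos h.elliptic source_nonneg (summable_source h.summable)
    h.nonneg h.summable_P).trans ?_
  have := tsum_source_le h.pos h.summable
  have h0 : 0 ≤ dx * ∑' j, source dx u j := mul_nonneg h.pos.le (tsum_nonneg source_nonneg)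
  gcongr

theorem Dp_eq (dx : ℝ) (u : ℤ → ℝ) (j : ℤ) : Dp dx u j = Dm dx u (j + 1) := by
  simp [Dp, Dm]

theorem sq_velocity_le (h : IsLevel dx u P) (j : ℤ) : velocity dx u P j ^ 2
    ≤ 4 * energy dx u * (Dm dx u j ^ 2 + Dm dx u (j + 1) ^ 2) + 2 * Dp dx P j ^ 2 := by
  have h1 := sq_le_two_energy h.pos h.summable j
  rw [velocity, Dp_eq dx u]
  set a := Dm dx u j
  set b := Dm dx u (j + 1)
  set c := Dp dx P j
  have h2 : (max (u j) 0 * a + min (u j) 0 * b) ^ 2 ≤ u j ^ 2 * (a ^ 2 + b ^ 2) := by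
    rcases le_total (u j) 0 with h | h <;> simp only [h, max_eq_right, max_eq_left, min_eq_left,
      min_eq_right, zero_mul, zero_add, add_zero, mul_pow] <;> gcongr <;>
      linarith [sq_nonneg a, sq_nonneg b]
  have h3 : u j ^ 2 * (a ^ 2 + b ^ 2) ≤ 2 * energy dx u * (a ^ 2 + b ^ 2) := by gcongr
  nlinarith [sq_nonneg (max (u j) 0 * a + min (u j) 0 * b - c)]

theorem summable_sq_velocity (h : IsLevel dx u P) : Summable fun j => velocity dx u P j ^ 2 := by
  have h1 := summable_sq_Dm h.summable
  refine summable_of_abs_le (((h1.add (summable_shift_add h1 1)).mul_left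
    (4 * energy dx u)).add ((summable_sq_Dp (dx := dx) h.summable_sq_P).mul_left 2)) fun j => ?_
  rw [abs_of_nonneg (sq_nonneg _)]
  exact h.sq_velocity_le j

theorem tsum_sq_velocity_le (h : IsLevel dx u P) :
    dx * ∑' j, velocity dx u P j ^ 2 ≤ 12 * energy dx u ^ 2 := by
  have hdx := h.pos
  have h1 := summable_sq_Dm h.summable
  have h2 := summable_shift_add h1 1
  have h3 := summable_sq_Dp (dx := dx) h.summable_sq_P
  have h4 := h.summable_sq_velocity.tsum_le_tsum h.sq_velocity_le
    (((h1.add h2).mul_left (4 * energy dx u)).add (h3.mul_left 2))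
  rw [((h1.add h2).mul_left _).tsum_add (h3.mul_left 2), tsum_mul_left, tsum_mul_left,
    h1.tsum_add h2, tsum_shift_add (fun j => Dm dx u j ^ 2)] at h4
  have h5 := mul_le_mul_of_nonneg_left h4 hdx.le
  have h6 := h.tsum_sq_Dp_P_le
  have h7 := energy_eq h.summable
  have h8 : 0 ≤ dx * ∑' j, u j ^ 2 := mul_nonneg hdx.le (tsum_nonneg fun _ => sq_nonneg _)
  have h9 : dx * ∑' j, Dm dx u j ^ 2 ≤ energy dx u := by linarith
  have h10 := mul_le_mul_of_nonneg_left h9 (energy_nonneg hdx (u := u))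
  linarith

theorem sq_Dm_le {dx : ℝ} (w : ℤ → ℝ) (j : ℤ) :
    Dm dx w j ^ 2 ≤ 2 / dx ^ 2 * (w j ^ 2 + w (j - 1) ^ 2) := by
  rw [Dm, div_pow, div_mul_eq_mul_div]
  gcongr
  nlinarith [sq_nonneg (w j + w (j - 1))]

theorem summable_sq_Dm_velocity (h : IsLevel dx u P) :
    Summable fun j => Dm dx (velocity dx u P) j ^ 2 := by
  have h1 := h.summable_sq_velocity
  refine summable_of_abs_le ((h1.add (summable_shift_sub h1 1)).mul_left (2 / dx ^ 2))
    fun j => ?_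
  rw [abs_of_nonneg (sq_nonneg _)]
  exact sq_Dm_le _ j

theorem tsum_sq_Dm_velocity_le (h : IsLevel dx u P) :
    dx * ∑' j, Dm dx (velocity dx u P) j ^ 2 ≤ 48 / dx ^ 2 * energy dx u ^ 2 := by
  have hdx := h.pos
  have h1 := h.summable_sq_velocity
  have h2 := summable_shift_sub h1 1
  have h4 := h.summable_sq_Dm_velocity.tsum_le_tsum (sq_Dm_le _)
    ((h1.add h2).mul_left (2 / dx ^ 2))
  rw [tsum_mul_left, h1.tsum_add h2, tsum_shift_sub (fun j => velocity dx u P j ^ 2)] at h4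
  calc _ ≤ dx * (2 / dx ^ 2 * (∑' j, velocity dx u P j ^ 2 + ∑' j, velocity dx u P j ^ 2)) := by
        gcongr
    _ = 4 / dx ^ 2 * (dx * ∑' j, velocity dx u P j ^ 2) := by ring
    _ ≤ 4 / dx ^ 2 * (12 * energy dx u ^ 2) :=
        mul_le_mul_of_nonneg_left h.tsum_sq_velocity_le (by positivity)
    _ = _ := by ring

/-- The time derivative of `q = D₋u`: advection of `q`, the Riccati term `q² / 2`, and lower
order terms. The elliptic equation removes the second differences of `P`. -/
theorem Dm_velocity (h : IsLevel dx u P) (j : ℤ) : Dm dx (velocity dx u P) j =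
    -(max (u (j - 1)) 0 * Dm dx (Dm dx u) j + min (u j) 0 * Dp dx (Dm dx u) j
      + Dm dx u j ^ 2 / 2 + P j - (max (u j) 0 ^ 2 + min (u (j - 1)) 0 ^ 2)) := by
  have hdx := h.pos.ne'
  have h1 := h.elliptic j
  have e0 := max_add_min (u j) 0
  have e1 := max_add_min (u (j - 1)) 0
  have h2 : Dm dx (velocity dx u P) j = -Dm dx (Dp dx P) j
      - (max (u j) 0 * Dm dx u j + min (u j) 0 * Dm dx u (j + 1)
        - max (u (j - 1)) 0 * Dm dx u (j - 1) - min (u (j - 1)) 0 * Dm dx u j) / dx := by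
    rw [Dm, velocity, velocity, Dp_eq dx u, Dp_eq dx u, sub_add_cancel, Dm.eq_1 dx (Dp dx P)]
    ring
  have h3 : Dm dx u j = (u j - u (j - 1)) / dx := rfl
  have h4 : (max (u j) 0 - max (u (j - 1)) 0 + min (u j) 0 - min (u (j - 1)) 0)
      = dx * Dm dx u j := by
    rw [h3, mul_div_cancel₀ _ hdx]; linarith
  rw [h2, eq_sub_of_add_eq h1, source, Dm.eq_1 dx (Dm dx u), Dp.eq_1 dx (Dm dx u)]
  field_simp
  linear_combination (-2) * Dm dx u j * h4

/-- The energy flux through the node `j`. -/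
noncomputable def energyFlux (dx : ℝ) (u P : ℤ → ℝ) (j : ℤ) : ℝ :=
  u j * P (j + 1) + dx * min (u j) 0 ^ 2 * Dm dx u (j + 1)
    + (max (u j) 0 * Dm dx u j ^ 2 + min (u j) 0 * Dm dx u (j + 1) ^ 2) / 2

/-- Local energy balance: up to a discrete divergence, energy is only lost to viscosity. -/
theorem local_energy_balance (h : IsLevel dx u P) (j : ℤ) :
    dx * (u j * velocity dx u P j + Dm dx u j * Dm dx (velocity dx u P) j)
      = -(dx ^ 2 / 2) * viscosity dx u j
        - (energyFlux dx u P j - energyFlux dx u P (j - 1)) := by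
  have hdx := h.pos.ne'
  rw [h.Dm_velocity, velocity, viscosity, energyFlux, energyFlux, Dp_eq dx u, sub_add_cancel,
    Dm.eq_1 dx (Dm dx u), Dp.eq_1 dx (Dm dx u), Dp.eq_1 dx P]
  have e0 := max_add_min (u j) 0
  have e1 := max_add_min (u (j - 1)) 0
  have f0 : max (u j) 0 * min (u j) 0 = 0 := by
    rcases le_total (u j) 0 with h | h <;> simp [h]
  have h3 : u j - u (j - 1) = dx * Dm dx u j := by rw [Dm, mul_div_cancel₀ _ hdx]
  set a := Dm dx u j
  set b := Dm dx u (j + 1)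
  set c := Dm dx u (j - 1)
  set p := max (u j) 0
  set m := min (u j) 0
  set p' := max (u (j - 1)) 0
  set m' := min (u (j - 1)) 0
  rw [add_zero] at e0 e1
  rw [← e0, ← e1] at h3 ⊢
  field_simp
  linear_combination (2 * P j + a ^ 2) * h3 + (-2 * dx * (a + b)) * f0

theorem abs_u_le (h : IsLevel dx u P) (j : ℤ) : |u j| ≤ 1 / 2 + energy dx u := by
  have := sq_le_two_energy h.pos h.summable j
  nlinarith [sq_nonneg (|u j| - 1), sq_abs (u j)]

theorem viscosity_nonneg (dx : ℝ) (u : ℤ → ℝ) (j : ℤ) : 0 ≤ viscosity dx u j := by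
  have h1 : 0 ≤ max (u (j - 1)) 0 * Dm dx (Dm dx u) j ^ 2 := by positivity
  have h2 : min (u j) 0 * Dp dx (Dm dx u) j ^ 2 ≤ 0 :=
    mul_nonpos_of_nonpos_of_nonneg (min_le_right _ _) (sq_nonneg _)
  rw [viscosity]
  linarith

theorem max_le_abs (x : ℝ) : max x 0 ≤ |x| := max_le (le_abs_self x) (abs_nonneg x)

theorem neg_abs_le_min (x : ℝ) : -|x| ≤ min x 0 :=
  le_min (neg_abs_le x) (neg_nonpos.2 (abs_nonneg x))

theorem summable_viscosity (h : IsLevel dx u P) : Summable (viscosity dx u) := by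
  have h1 := summable_sq_Dm h.summable
  have h2 : Summable fun j => Dm dx (Dm dx u) j ^ 2 :=
    summable_of_abs_le ((h1.add (summable_shift_sub h1 1)).mul_left (2 / dx ^ 2)) fun j => by
      rw [abs_of_nonneg (sq_nonneg _)]
      exact sq_Dm_le _ j
  refine summable_of_abs_le (((h2.add (summable_sq_Dp (dx := dx) h1)).mul_left (1 / 2 + energy dx u)))
    fun j => ?_
  rw [abs_of_nonneg (viscosity_nonneg _ _ _), viscosity, mul_add, sub_eq_add_neg, ← neg_mul]
  have a1 := (max_le_abs (u (j - 1))).trans (h.abs_u_le _)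
  have a2 : -min (u j) 0 ≤ 1 / 2 + energy dx u := by
    linarith [neg_abs_le_min (u j), h.abs_u_le j]
  gcongr

theorem summable_energyFlux (h : IsLevel dx u P) : Summable (energyFlux dx u P) := by
  have hdx := h.pos
  have h1 := summable_sq h.summable
  have h2 := summable_sq_Dm h.summable
  have h3 := summable_shift_add h2 1
  have h4 := summable_shift_add h.summable_sq_P 1
  have hE := energy_nonneg hdx (u := u)
  refine ((summable_of_abs_le (h1.add h4) fun j => ?_).add
    (summable_of_abs_le (((h1.add h3).mul_left (dx * (1 / 2 + energy dx u)))) fun j => ?_)).add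
    ((summable_of_abs_le ((h2.add h3).mul_left (1 / 2 + energy dx u)) fun j => ?_).div_const 2)
  · refine abs_le.2 ⟨?_, ?_⟩ <;>
    nlinarith [sq_nonneg (u j - P (j + 1)), sq_nonneg (u j + P (j + 1))]
  · have a1 := h.abs_u_le j
    have a2 : |min (u j) 0| ≤ |u j| := by
      rw [abs_of_nonpos (min_le_right _ _)]; linarith [neg_abs_le_min (u j)]
    rw [abs_mul, abs_mul, abs_of_pos hdx, abs_of_nonneg (sq_nonneg _), mul_assoc, mul_assoc]
    refine mul_le_mul_of_nonneg_left ?_ hdx.le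
    have a3 : min (u j) 0 ^ 2 ≤ |u j| * (1 / 2 + energy dx u) := by
      rw [← sq_abs, sq]
      gcongr
      exact a2.trans a1
    have a4 : |u j| * |Dm dx u (j + 1)| ≤ u j ^ 2 + Dm dx u (j + 1) ^ 2 := by
      nlinarith [sq_nonneg (|u j| - |Dm dx u (j + 1)|), sq_abs (u j), sq_abs (Dm dx u (j + 1)),
        sq_nonneg (u j), sq_nonneg (Dm dx u (j + 1))]
    calc _ ≤ |u j| * (1 / 2 + energy dx u) * |Dm dx u (j + 1)| := by gcongr
      _ = (1 / 2 + energy dx u) * (|u j| * |Dm dx u (j + 1)|) := by ring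
      _ ≤ _ := by gcongr
  · have a1 := (max_le_abs (u j)).trans (h.abs_u_le _)
    have a2 := (neg_abs_le_min (u j))
    have a3 := h.abs_u_le j
    have a4 : 0 ≤ max (u j) 0 := le_max_right _ _
    have a5 : min (u j) 0 ≤ 0 := min_le_right _ _
    have b1 : |max (u j) 0 * Dm dx u j ^ 2| ≤ (1 / 2 + energy dx u) * Dm dx u j ^ 2 := by
      rw [abs_mul, abs_of_nonneg a4, abs_of_nonneg (sq_nonneg _)]
      gcongr
    have b2 : |min (u j) 0 * Dm dx u (j + 1) ^ 2|
        ≤ (1 / 2 + energy dx u) * Dm dx u (j + 1) ^ 2 := by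
      rw [abs_mul, abs_of_nonpos a5, abs_of_nonneg (sq_nonneg _)]
      gcongr
      linarith
    linarith [abs_add_le (max (u j) 0 * Dm dx u j ^ 2) (min (u j) 0 * Dm dx u (j + 1) ^ 2)]

theorem summable_add_velocity (h : IsLevel dx u P) {v : ℤ → ℝ} {k : ℝ}
    (hv : ∀ j, v j = u j + k * velocity dx u P j) :
    Summable fun j => v j ^ 2 + Dm dx v j ^ 2 := by
  have h1 := (summable_sq h.summable).add (h.summable_sq_velocity.mul_left (k ^ 2))
  have h2 : Summable fun j => v j ^ 2 := summable_of_abs_le (h1.mul_left 2) fun j => by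
    rw [abs_of_nonneg (sq_nonneg _), hv]
    nlinarith [sq_nonneg (u j - k * velocity dx u P j)]
  refine h2.add (summable_of_abs_le ((h2.add (summable_shift_sub h2 1)).mul_left (2 / dx ^ 2))
    fun j => ?_)
  rw [abs_of_nonneg (sq_nonneg _)]
  exact sq_Dm_le _ j

theorem Dm_add_velocity {v : ℤ → ℝ} {k : ℝ} (hv : ∀ j, v j = u j + k * velocity dx u P j)
    (j : ℤ) : Dm dx v j = Dm dx u j + k * Dm dx (velocity dx u P) j := by
  rw [Dm, hv, hv, Dm, Dm]; ring

/-- One Euler step dissipates energy through the viscosity, up to an error quadratic in the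
time step. -/
theorem energy_step (h : IsLevel dx u P) {v : ℤ → ℝ} {k : ℝ}
    (hv : ∀ j, v j = u j + k * velocity dx u P j) :
    energy dx v + k * (dx ^ 2 * ∑' j, viscosity dx u j)
      ≤ energy dx u + 48 * k ^ 2 * (1 + 1 / dx ^ 2) * energy dx u ^ 2 := by
  have hdx := h.pos
  have s1 := summable_sq_Dm h.summable
  have s2 := h.summable
  have s3 := h.summable_viscosity
  have s4 := h.summable_energyFlux
  have s5 := h.summable_sq_velocity
  have s6 := h.summable_sq_Dm_velocity
  have s7 := s4.sub (summable_shift_sub s4 1)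
  have e : ∀ j, dx * (v j ^ 2 + Dm dx v j ^ 2) = dx * (u j ^ 2 + Dm dx u j ^ 2)
      - k * dx ^ 2 * viscosity dx u j - 2 * k * (energyFlux dx u P j - energyFlux dx u P (j - 1))
      + k ^ 2 * dx * (velocity dx u P j ^ 2 + Dm dx (velocity dx u P) j ^ 2) := by
    intro j
    have := h.local_energy_balance j
    rw [Dm_add_velocity hv, hv]
    linear_combination 2 * k * this
  have h1 : energy dx v = energy dx u - k * dx ^ 2 * ∑' j, viscosity dx u j
      + k ^ 2 * dx * (∑' j, velocity dx u P j ^ 2 + ∑' j, Dm dx (velocity dx u P) j ^ 2) := by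
    rw [energy, ← tsum_mul_left]
    simp only [e]
    rw [(((s2.mul_left _).sub (s3.mul_left _)).sub (s7.mul_left _)).tsum_add
      ((s5.add s6).mul_left _), ((s2.mul_left _).sub (s3.mul_left _)).tsum_sub (s7.mul_left _),
      (s2.mul_left _).tsum_sub (s3.mul_left _), tsum_mul_left, tsum_mul_left, tsum_mul_left,
      tsum_mul_left, tsum_sub_shift s4, s5.tsum_add s6, energy]
    ring
  have h2 := mul_le_mul_of_nonneg_left
    (add_le_add h.tsum_sq_velocity_le h.tsum_sq_Dm_velocity_le) (sq_nonneg k)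
  have h3 : 48 * k ^ 2 * (1 + 1 / dx ^ 2) * energy dx u ^ 2
      = k ^ 2 * (12 * energy dx u ^ 2 + 48 / dx ^ 2 * energy dx u ^ 2)
        + 36 * k ^ 2 * energy dx u ^ 2 := by ring
  have h4 : 0 ≤ 36 * k ^ 2 * energy dx u ^ 2 := by positivity
  rw [h1, h3]
  linarith

end IsLevel
/-! ### Renormalized equation over one time step -/

/-- `f` is a renormalization with derivative `g`: `f'` is Lipschitz (in integrated form, with
constant `L`) and both functions grow at most quadratically. -/
structure IsRenormalization (f g : ℝ → ℝ) (L : ℝ) : Prop where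
  nonneg : 0 ≤ L
  taylor : ∀ a b, |f b - f a - g a * (b - a)| ≤ L * (b - a) ^ 2
  abs_le : ∀ x, |f x| ≤ 1 + x ^ 2
  abs_deriv_le : ∀ x, |g x| ≤ 2 * (1 + x ^ 2)

/-- `χ` is a spatial cut-off, with `η ≤ 1` dominating `χ` and its difference quotients and of
total mass at most `W`. -/
structure IsCutoff (dx : ℝ) (χ η : ℤ → ℝ) (W : ℝ) : Prop where
  nonneg : ∀ j, 0 ≤ χ j
  le : ∀ j, χ j ≤ η j
  le_one : ∀ j, η j ≤ 1
  summable : Summable η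
  mass_le : dx * ∑' j, η j ≤ W
  abs_add_sub_le : ∀ j, |χ (j + 1) - χ j| ≤ dx * η j
  abs_sub_sub_le : ∀ j, |χ j - χ (j - 1)| ≤ dx * η j

namespace IsLevel

variable {dx : ℝ} {u P : ℤ → ℝ}

/-- The flux of the renormalized quantity `χ f(q)` through the node `j`. -/
noncomputable def renormFlux (dx : ℝ) (u : ℤ → ℝ) (f : ℝ → ℝ) (χ : ℤ → ℝ) (j : ℤ) : ℝ :=
  χ (j + 1) * max (u j) 0 * f (Dm dx u j) + χ j * min (u j) 0 * f (Dm dx u (j + 1))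

theorem abs_P_sub_le (h : IsLevel dx u P) (j : ℤ) :
    |P j - (max (u j) 0 ^ 2 + min (u (j - 1)) 0 ^ 2)| ≤ 6 * energy dx u := by
  have h1 := h.nonneg j
  have h2 := h.P_le j
  have h3 := (max_sq_le (u j)).trans (sq_le_two_energy h.pos h.summable j)
  have h4 := (min_sq_le (u (j - 1))).trans (sq_le_two_energy h.pos h.summable (j - 1))
  have h5 := sq_nonneg (max (u j) 0)
  have h6 := sq_nonneg (min (u (j - 1)) 0)
  exact abs_le.2 ⟨by linarith, by linarith⟩

/-- Advection of `f(q)` by the upwind scheme. The compression `D₋u = q` yields `q f(q)`; the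
Taylor remainders of `f` are dominated by the viscosity. -/
theorem renorm_advection (h : IsLevel dx u P) {f g : ℝ → ℝ} {L : ℝ}
    (hf : IsRenormalization f g L) {χ η : ℤ → ℝ} {W : ℝ} (hχ : IsCutoff dx χ η W) (j : ℤ) :
    χ j * (Dm dx u j * f (Dm dx u j)) ≤
      -(χ j * g (Dm dx u j) * (max (u (j - 1)) 0 * Dm dx (Dm dx u) j
        + min (u j) 0 * Dp dx (Dm dx u) j))
      + L * dx * viscosity dx u j + (1 + 2 * energy dx u) * (η j + Dm dx u j ^ 2)
      + (renormFlux dx u f χ j - renormFlux dx u f χ (j - 1)) / dx := by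
  have hdx := h.pos
  have t1 := hf.taylor (Dm dx u j) (Dm dx u (j - 1))
  have t2 := hf.taylor (Dm dx u j) (Dm dx u (j + 1))
  have hd : Dm dx u (j - 1) = Dm dx u j - dx * Dm dx (Dm dx u) j := by
    rw [Dm.eq_1 dx (Dm dx u), mul_div_cancel₀ _ hdx.ne']; ring
  have hd' : Dm dx u (j + 1) = Dm dx u j + dx * Dp dx (Dm dx u) j := by
    rw [Dp.eq_1 dx (Dm dx u), mul_div_cancel₀ _ hdx.ne']; ring
  have hq : u j - u (j - 1) = dx * Dm dx u j := by rw [Dm, mul_div_cancel₀ _ hdx.ne']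
  have a1 := h.abs_u_le j
  have a2 := h.abs_u_le (j - 1)
  have e0 := max_add_min (u j) 0
  have e1 := max_add_min (u (j - 1)) 0
  have p0 : 0 ≤ max (u (j - 1)) 0 := le_max_right _ _
  have m0 : 0 ≤ -min (u j) 0 := neg_nonneg.2 (min_le_right _ _)
  have b1 : |max (u j) 0| ≤ 1 / 2 + energy dx u := by
    rw [abs_of_nonneg (le_max_right _ _)]; exact (max_le_abs _).trans a1
  have b2 : |min (u (j - 1)) 0| ≤ 1 / 2 + energy dx u := by
    rw [abs_of_nonpos (min_le_right _ _)]; linarith [neg_abs_le_min (u (j - 1))]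
  have c1 := hχ.nonneg j
  have c2 := (hχ.le j).trans (hχ.le_one j)
  have c3 := hχ.abs_add_sub_le j
  have c4 := hχ.abs_sub_sub_le j
  have c5 := hf.abs_le (Dm dx u j)
  have η0 : 0 ≤ η j := c1.trans (hχ.le j)
  have η1 := hχ.le_one j
  have hE := energy_nonneg hdx (u := u)
  have hv := viscosity_nonneg dx u j
  rw [add_zero] at e0 e1
  have key : χ j * (dx * (Dm dx u j * f (Dm dx u j))) ≤
      -(χ j * (dx * g (Dm dx u j)) * (max (u (j - 1)) 0 * Dm dx (Dm dx u) j
        + min (u j) 0 * Dp dx (Dm dx u) j))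
      + L * dx ^ 2 * viscosity dx u j + dx * ((1 + 2 * energy dx u) * (η j + Dm dx u j ^ 2))
      + (renormFlux dx u f χ j - renormFlux dx u f χ (j - 1)) := by
    have v1 : χ j * (L * dx ^ 2 * viscosity dx u j) ≤ L * dx ^ 2 * viscosity dx u j :=
      mul_le_of_le_one_left (mul_nonneg (mul_nonneg hf.nonneg (sq_nonneg _)) hv) c2
    rw [viscosity] at v1 ⊢
    rw [renormFlux, renormFlux, sub_add_cancel]
    rw [hd] at t1 ⊢
    rw [hd'] at t2 ⊢
    set q := Dm dx u j
    set d := Dm dx (Dm dx u) j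
    set d' := Dp dx (Dm dx u) j
    set p := max (u j) 0
    set m := min (u j) 0
    set p' := max (u (j - 1)) 0
    set m' := min (u (j - 1)) 0
    set E := energy dx u
    have s1 := mul_le_mul_of_nonneg_left (abs_le.1 t1).2 (mul_nonneg c1 p0)
    have s2 := mul_le_mul_of_nonneg_left (abs_le.1 t2).2 (mul_nonneg c1 m0)
    have r1 : |f q * p * (χ (j + 1) - χ j)| ≤ (1 + q ^ 2) * (1 / 2 + E) * (dx * η j) := by
      rw [abs_mul, abs_mul]; gcongr
    have r2 : |f q * m' * (χ j - χ (j - 1))| ≤ (1 + q ^ 2) * (1 / 2 + E) * (dx * η j) := by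
      rw [abs_mul, abs_mul]; gcongr
    have r3 : (1 + q ^ 2) * η j ≤ η j + q ^ 2 := by nlinarith [sq_nonneg q]
    have r4 : (1 + q ^ 2) * (1 / 2 + E) * (dx * η j) * 2 ≤ dx * ((1 + 2 * E) * (η j + q ^ 2)) := by
      calc _ = dx * ((1 + 2 * E) * ((1 + q ^ 2) * η j)) := by ring
        _ ≤ _ := by gcongr
    have r5 := (abs_le.1 r1).2
    have r6 := (abs_le.1 r2).2
    have r7 := (abs_le.1 r1).1
    have r8 := (abs_le.1 r2).1
    have hq' : χ j * f q * (p + m - (p' + m')) = χ j * f q * (dx * q) := by rw [e0, e1, hq]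
    linarith
  have := div_le_div_of_nonneg_right key hdx.le
  have e2 : χ j * (dx * (Dm dx u j * f (Dm dx u j))) / dx
      = χ j * (Dm dx u j * f (Dm dx u j)) := by field_simp
  rw [e2] at this
  refine this.trans (le_of_eq ?_)
  field_simp

/-- Local form of the renormalized equation. The factor `q f(q) - q² f'(q) / 2` is the balance
between the compression and the Riccati term `q² / 2`. -/
theorem local_renorm_step (h : IsLevel dx u P) {f g : ℝ → ℝ} {L : ℝ}
    (hf : IsRenormalization f g L) {χ η : ℤ → ℝ} {W : ℝ} (hχ : IsCutoff dx χ η W)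
    {v : ℤ → ℝ} {k : ℝ} (hk : 0 ≤ k) (hv : ∀ j, v j = u j + k * velocity dx u P j) (j : ℤ) :
    k * (χ j * (Dm dx u j * f (Dm dx u j) - Dm dx u j ^ 2 * g (Dm dx u j) / 2)) ≤
      χ j * f (Dm dx v j) - χ j * f (Dm dx u j) + L * k ^ 2 * Dm dx (velocity dx u P) j ^ 2
      + k * L * dx * viscosity dx u j + k * (1 + 14 * energy dx u) * (η j + Dm dx u j ^ 2)
      + k / dx * (renormFlux dx u f χ j - renormFlux dx u f χ (j - 1)) := by
  have h1 := mul_le_mul_of_nonneg_left (h.renorm_advection hf hχ j) hk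
  have h2 := hf.taylor (Dm dx u j) (Dm dx v j)
  have c1 := hχ.nonneg j
  have c2 := (hχ.le j).trans (hχ.le_one j)
  have η1 := hχ.le_one j
  have h3 := h.Dm_velocity j
  have hE := energy_nonneg h.pos (u := u)
  rw [Dm_add_velocity hv] at h2 ⊢
  set w := Dm dx (velocity dx u P) j
  have h4 : |χ j * g (Dm dx u j) * (P j - (max (u j) 0 ^ 2 + min (u (j - 1)) 0 ^ 2))|
      ≤ 12 * energy dx u * (η j + Dm dx u j ^ 2) := by
    rw [abs_mul, abs_mul, abs_of_nonneg c1]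
    calc _ ≤ η j * (2 * (1 + Dm dx u j ^ 2)) * (6 * energy dx u) := by
          have := hχ.le j
          have := hf.abs_deriv_le (Dm dx u j)
          have := h.abs_P_sub_le j
          have := c1.trans (hχ.le j)
          gcongr
      _ = 12 * energy dx u * (η j + η j * Dm dx u j ^ 2) := by ring
      _ ≤ _ := by
        gcongr
        exact mul_le_of_le_one_left (sq_nonneg _) η1
  set q := Dm dx u j
  set R := P j - (max (u j) 0 ^ 2 + min (u (j - 1)) 0 ^ 2) with hR
  have h5 : max (u (j - 1)) 0 * Dm dx (Dm dx u) j + min (u j) 0 * Dp dx (Dm dx u) j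
      = -w - q ^ 2 / 2 - R := by rw [h3, hR]; ring
  rw [h5] at h1
  have h6 := mul_le_mul_of_nonneg_left (abs_le.1 h2).1 c1
  have h7 : χ j * (L * (q + k * w - q) ^ 2) ≤ L * k ^ 2 * w ^ 2 := by
    refine (mul_le_of_le_one_left (mul_nonneg hf.nonneg (sq_nonneg _)) c2).trans (le_of_eq ?_)
    ring
  have h8 := mul_le_mul_of_nonneg_left (abs_le.1 h4).1 hk
  have h9 := mul_le_mul_of_nonneg_left (abs_le.1 h4).2 hk
  ring_nf at *
  linarith

theorem summable_cutoff_mul {f : ℝ → ℝ} (hf : ∀ x, |f x| ≤ 1 + x ^ 2) {χ η : ℤ → ℝ} {W : ℝ}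
    (hχ : IsCutoff dx χ η W) {r : ℤ → ℝ} (hr : Summable fun j => r j ^ 2) :
    Summable fun j => χ j * f (r j) := by
  refine summable_of_abs_le (hχ.summable.add hr) fun j => ?_
  have c1 := hχ.nonneg j
  have η0 : 0 ≤ η j := c1.trans (hχ.le j)
  rw [abs_mul, abs_of_nonneg c1]
  calc _ ≤ η j * (1 + r j ^ 2) := by
        have := hχ.le j
        have := hf (r j)
        gcongr
    _ = η j + η j * r j ^ 2 := by ring
    _ ≤ _ := by
      gcongr
      exact mul_le_of_le_one_left (sq_nonneg _) (hχ.le_one j)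

theorem summable_renormFlux (h : IsLevel dx u P) {f : ℝ → ℝ} (hf : ∀ x, |f x| ≤ 1 + x ^ 2)
    {χ η : ℤ → ℝ} {W : ℝ} (hχ : IsCutoff dx χ η W) : Summable (renormFlux dx u f χ) := by
  have h1 := summable_sq_Dm h.summable
  have h2 : Summable fun j => χ (j + 1) * f (Dm dx u j) := by
    have := summable_shift_add
      (summable_cutoff_mul hf hχ (r := fun j => Dm dx u (j - 1)) (summable_shift_sub h1 1)) 1
    simpa using this
  have h3 : Summable fun j => χ j * f (Dm dx u (j + 1)) :=
    summable_cutoff_mul hf hχ (r := fun j => Dm dx u (j + 1)) (summable_shift_add h1 1)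
  refine (summable_of_abs_le (h2.abs.mul_left (1 / 2 + energy dx u)) fun j => ?_).add
    (summable_of_abs_le (h3.abs.mul_left (1 / 2 + energy dx u)) fun j => ?_)
  · rw [mul_right_comm, abs_mul, mul_comm, abs_of_nonneg (le_max_right (u j) 0)]
    exact mul_le_mul_of_nonneg_right ((max_le_abs _).trans (h.abs_u_le j)) (abs_nonneg _)
  · rw [mul_right_comm, abs_mul, mul_comm, abs_of_nonpos (min_le_right (u j) 0)]
    refine mul_le_mul_of_nonneg_right ?_ (abs_nonneg _)
    linarith [neg_abs_le_min (u j), h.abs_u_le j]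

theorem mass_add_tsum_le (h : IsLevel dx u P) {χ η : ℤ → ℝ} {W : ℝ} (hχ : IsCutoff dx χ η W) :
    dx * ∑' j, (η j + Dm dx u j ^ 2) ≤ W + energy dx u := by
  have h1 := summable_sq_Dm h.summable
  have h2 : 0 ≤ dx * ∑' j, u j ^ 2 := mul_nonneg h.pos.le (tsum_nonneg fun _ => sq_nonneg _)
  rw [hχ.summable.tsum_add h1, mul_add]
  linarith [energy_eq h.summable, hχ.mass_le]

/-- The local renormalized balance summed over space; the flux disappears. The hypothesis on
`Q` is the coercivity that turns the balance into a bound on a higher power of `q`. -/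
theorem renorm_step (h : IsLevel dx u P) {f g : ℝ → ℝ} {L : ℝ}
    (hf : IsRenormalization f g L) {χ η : ℤ → ℝ} {W : ℝ} (hχ : IsCutoff dx χ η W)
    {v : ℤ → ℝ} {k : ℝ} (hk : 0 ≤ k) (hv : ∀ j, v j = u j + k * velocity dx u P j)
    {Q : ℝ → ℝ} (hQ : ∀ x, Q x ≤ x * f x - x ^ 2 * g x / 2)
    (hQs : Summable fun j => χ j * Q (Dm dx u j)) :
    k * (dx * ∑' j, χ j * Q (Dm dx u j)) ≤
      dx * ∑' j, χ j * f (Dm dx v j) - dx * ∑' j, χ j * f (Dm dx u j)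
      + L * (k ^ 2 * (dx * ∑' j, Dm dx (velocity dx u P) j ^ 2))
      + L * (k * (dx ^ 2 * ∑' j, viscosity dx u j))
      + k * (1 + 14 * energy dx u) * (W + energy dx u) := by
  have hdx := h.pos
  have s1 := summable_cutoff_mul hf.abs_le hχ (summable_sq_Dm h.summable)
  have s2 := summable_cutoff_mul hf.abs_le hχ (summable_sq_Dm (h.summable_add_velocity hv))
  have s3 := h.summable_sq_Dm_velocity.mul_left (L * k ^ 2)
  have s4 := h.summable_viscosity.mul_left (k * L * dx)
  have s5 := (hχ.summable.add (summable_sq_Dm h.summable)).mul_left (k * (1 + 14 * energy dx u))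
  have s6 := h.summable_renormFlux hf.abs_le hχ
  have s7 := (s6.sub (summable_shift_sub s6 1)).mul_left (k / dx)
  have h1 := (hQs.mul_left k).tsum_le_tsum (fun j =>
    (mul_le_mul_of_nonneg_left (mul_le_mul_of_nonneg_left (hQ _) (hχ.nonneg j)) hk).trans
      (h.local_renorm_step hf hχ hk hv j)) (((((s2.sub s1).add s3).add s4).add s5).add s7)
  rw [((((s2.sub s1).add s3).add s4).add s5).tsum_add s7,
    (((s2.sub s1).add s3).add s4).tsum_add s5, ((s2.sub s1).add s3).tsum_add s4,
    (s2.sub s1).tsum_add s3, s2.tsum_sub s1, tsum_mul_left, tsum_mul_left, tsum_mul_left,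
    tsum_mul_left, tsum_mul_left, tsum_sub_shift s6] at h1
  have h2 := mul_le_mul_of_nonneg_left h1 hdx.le
  have hE := energy_nonneg hdx (u := u)
  have h3 := mul_le_mul_of_nonneg_left (h.mass_add_tsum_le hχ)
    (by positivity : 0 ≤ k * (1 + 14 * energy dx u))
  ring_nf at h2 h3 ⊢
  linarith

/-- Weighted sums of a function of quadratic growth are controlled by the energy. -/
theorem abs_tsum_cutoff_mul_le (h : IsLevel dx u P) {f : ℝ → ℝ} (hf : ∀ x, |f x| ≤ 1 + x ^ 2)
    {χ η : ℤ → ℝ} {W : ℝ} (hχ : IsCutoff dx χ η W) :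
    |dx * ∑' j, χ j * f (Dm dx u j)| ≤ W + energy dx u := by
  have hdx := h.pos
  have s1 := summable_cutoff_mul hf hχ (summable_sq_Dm h.summable)
  have s2 := hχ.summable.add (summable_sq_Dm h.summable)
  have hle : ∀ j, |χ j * f (Dm dx u j)| ≤ η j + Dm dx u j ^ 2 := fun j => by
    have c1 := hχ.nonneg j
    have η0 : 0 ≤ η j := c1.trans (hχ.le j)
    rw [abs_mul, abs_of_nonneg c1]
    nlinarith [mul_le_mul (hχ.le j) (hf (Dm dx u j)) (abs_nonneg _) η0,
      mul_le_of_le_one_left (sq_nonneg (Dm dx u j)) (hχ.le_one j)]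
  rw [abs_mul, abs_of_pos hdx]
  refine (mul_le_mul_of_nonneg_left ?_ hdx.le).trans (h.mass_add_tsum_le hχ)
  have h1 : |∑' j, χ j * f (Dm dx u j)| ≤ ∑' j, |χ j * f (Dm dx u j)| := by
    simpa only [Real.norm_eq_abs] using norm_tsum_le_tsum_norm (f := fun j => χ j * f (Dm dx u j))
      s1.norm
  exact h1.trans (s1.abs.tsum_le_tsum hle s2)

end IsLevel
/-! ### Sampling a function in `H¹(ℝ)` -/

section Mollifier

/-- The mollified indicator of `(x, y)`. -/
noncomputable def smoothIndicator (φ : ContDiffBump (0 : ℝ)) (x y z : ℝ) : ℝ :=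
  (∫ s in (0 : ℝ)..(z - x), φ.normed volume s) - ∫ s in (0 : ℝ)..(z - y), φ.normed volume s

variable (φ : ContDiffBump (0 : ℝ)) (x y : ℝ)

theorem smoothIndicator_eq (z : ℝ) :
    smoothIndicator φ x y z = ∫ s in (z - y)..(z - x), φ.normed volume s :=
  intervalIntegral.integral_interval_sub_left (φ.continuous_normed.intervalIntegrable _ _)
    (φ.continuous_normed.intervalIntegrable _ _)

theorem hasDerivAt_smoothIndicator (z : ℝ) : HasDerivAt (smoothIndicator φ x y)
    (φ.normed volume (z - x) - φ.normed volume (z - y)) z := by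
  have h : ∀ w : ℝ, HasDerivAt (fun t => ∫ s in (0 : ℝ)..t, φ.normed volume s)
      (φ.normed volume w) w := fun w =>
    (φ.continuous_normed.integral_hasStrictDerivAt 0 w).hasDerivAt
  exact ((h (z - x)).comp_sub_const z x).sub ((h (z - y)).comp_sub_const z y)

theorem contDiff_smoothIndicator : ContDiff ℝ ∞ (smoothIndicator φ x y) := by
  have hd : deriv (smoothIndicator φ x y)
      = fun z => φ.normed volume (z - x) - φ.normed volume (z - y) :=
    funext fun z => (hasDerivAt_smoothIndicator φ x y z).deriv
  refine contDiff_infty_iff_deriv.2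
    ⟨fun z => (hasDerivAt_smoothIndicator φ x y z).differentiableAt, ?_⟩
  rw [hd]
  have h : ContDiff ℝ ∞ (φ.normed volume) := φ.contDiff_normed
  exact (h.comp (contDiff_id.sub contDiff_const)).sub (h.comp (contDiff_id.sub contDiff_const))

variable {x y}

theorem smoothIndicator_eq_zero (hxy : x ≤ y) {z : ℝ}
    (hz : z ∉ Set.Icc (x - φ.rOut) (y + φ.rOut)) : smoothIndicator φ x y z = 0 := by
  rw [smoothIndicator_eq]
  refine (intervalIntegral.integral_congr (g := fun _ => 0) fun s hs => ?_).trans (by simp)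
  rw [Set.uIcc_of_le (by linarith)] at hs
  have : s ∉ Function.support (φ.normed volume) := by
    rw [φ.support_normed_eq, Metric.mem_ball, dist_zero_right, Real.norm_eq_abs, abs_lt]
    intro h
    exact hz ⟨by linarith [hs.2], by linarith [hs.1]⟩
  simpa using this

theorem abs_smoothIndicator_le (hxy : x ≤ y) (z : ℝ) : |smoothIndicator φ x y z| ≤ 1 := by
  rw [smoothIndicator_eq, intervalIntegral.integral_of_le (by linarith),
    abs_of_nonneg (integral_nonneg fun s => φ.nonneg_normed s), ← φ.integral_normed (μ := volume)]
  exact setIntegral_le_integral φ.integrable_normed (ae_of_all _ fun s => φ.nonneg_normed s)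

theorem hasCompactSupport_smoothIndicator (hxy : x ≤ y) :
    HasCompactSupport (smoothIndicator φ x y) :=
  HasCompactSupport.intro isCompact_Icc fun _ hz => smoothIndicator_eq_zero φ hxy hz

end Mollifier

namespace IsH1

variable {u u' : ℝ → ℝ}

theorem intervalIntegrable_abs (h : IsH1 u u') (a b : ℝ) :
    IntervalIntegrable (fun z => |u' z|) volume a b :=
  ((h.memLp_deriv.locallyIntegrable (by norm_num)).integrableOn_isCompact
    isCompact_uIcc).intervalIntegrable.abs

theorem integrable_sq (h : IsH1 u u') : Integrable fun z => u z ^ 2 := h.memLp.integrable_sq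

theorem integrable_deriv_sq (h : IsH1 u u') : Integrable fun z => u' z ^ 2 :=
  h.memLp_deriv.integrable_sq

/-- Testing the weak derivative with the mollified indicator of `(x, y)`. -/
theorem abs_mollified_sub_le (h : IsH1 u u') (φ : ContDiffBump (0 : ℝ)) {x y : ℝ} (hxy : x ≤ y) :
    |(∫ z, u z * φ.normed volume (z - x)) - ∫ z, u z * φ.normed volume (z - y)|
      ≤ ∫ z in (x - φ.rOut)..(y + φ.rOut), |u' z| := by
  have h1 := h.weakDeriv _ (contDiff_smoothIndicator φ x y)
    (hasCompactSupport_smoothIndicator φ hxy)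
  have hi : ∀ w : ℝ, Integrable fun z => u z * φ.normed volume (z - w) := fun w => by
    refine (h.continuous.mul (φ.continuous_normed.comp
      (continuous_id.sub continuous_const))).integrable_of_hasCompactSupport ?_
    exact (φ.hasCompactSupport_normed.comp_homeomorph (Homeomorph.subRight w)).mul_left
  have h2 : ∫ z, u z * deriv (smoothIndicator φ x y) z
      = (∫ z, u z * φ.normed volume (z - x)) - ∫ z, u z * φ.normed volume (z - y) := by
    rw [← integral_sub (hi x) (hi y)]
    refine integral_congr_ae (ae_of_all _ fun z => ?_)
    simp only [(hasDerivAt_smoothIndicator φ x y z).deriv]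
    ring
  have hr := φ.rOut_pos
  rw [← h2, h1, abs_neg, intervalIntegral.integral_of_le (by linarith),
    ← integral_Icc_eq_integral_Ioc, ← integral_indicator measurableSet_Icc]
  rw [← Real.norm_eq_abs]
  refine norm_integral_le_of_norm_le (g := (Set.Icc (x - φ.rOut) (y + φ.rOut)).indicator
    fun z => |u' z|) ?_ (ae_of_all _ fun z => ?_)
  · rw [integrable_indicator_iff measurableSet_Icc, ← intervalIntegrable_iff_integrableOn_Icc_of_le
      (by linarith)]
    exact h.intervalIntegrable_abs _ _
  · by_cases hz : z ∈ Set.Icc (x - φ.rOut) (y + φ.rOut)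
    · rw [Set.indicator_of_mem hz, norm_mul, Real.norm_eq_abs, Real.norm_eq_abs]
      exact mul_le_of_le_one_right (abs_nonneg _) (abs_smoothIndicator_le φ hxy z)
    · rw [Set.indicator_of_notMem hz, smoothIndicator_eq_zero φ hxy hz]
      simp

/-- The increments of the continuous representative are controlled by the weak derivative. -/
theorem abs_sub_le (h : IsH1 u u') {x y : ℝ} (hxy : x ≤ y) :
    |u y - u x| ≤ ∫ z in x..y, |u' z| := by
  have hpos : ∀ n : ℕ, (0 : ℝ) < 1 / ((n : ℝ) + 1) := fun n => by positivity
  let φ : ℕ → ContDiffBump (0 : ℝ) := fun n =>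
    ⟨1 / ((n : ℝ) + 1) / 2, 1 / ((n : ℝ) + 1), half_pos (hpos n), half_lt_self (hpos n)⟩
  have hφ : Filter.Tendsto (fun n => (φ n).rOut) Filter.atTop (nhds 0) :=
    tendsto_one_div_add_atTop_nhds_zero_nat
  have hconv : ∀ w : ℝ, Filter.Tendsto (fun n => ∫ z, u z * (φ n).normed volume (z - w))
      Filter.atTop (nhds (u w)) := fun w => by
    refine (ContDiffBump.convolution_tendsto_right_of_continuous (μ := volume) hφ
      h.continuous w).congr fun n => ?_
    rw [convolution_def, ← integral_sub_left_eq_self _ volume w]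
    refine integral_congr_ae (ae_of_all _ fun z => ?_)
    simp only [ContinuousLinearMap.lsmul_apply, smul_eq_mul, sub_sub_cancel]
    rw [← neg_sub z w, ContDiffBump.normed_neg, mul_comm]
  have hF : Continuous fun b => ∫ z in (0 : ℝ)..b, |u' z| :=
    intervalIntegral.continuous_primitive h.intervalIntegrable_abs 0
  have hsplit : ∀ a b : ℝ, ∫ z in a..b, |u' z|
      = (∫ z in (0 : ℝ)..b, |u' z|) - ∫ z in (0 : ℝ)..a, |u' z| := fun a b =>
    (intervalIntegral.integral_interval_sub_left (h.intervalIntegrable_abs _ _)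
      (h.intervalIntegrable_abs _ _)).symm
  have hlim : Filter.Tendsto (fun n => ∫ z in (x - (φ n).rOut)..(y + (φ n).rOut), |u' z|)
      Filter.atTop (nhds (∫ z in x..y, |u' z|)) := by
    rw [hsplit x y]
    refine (Filter.Tendsto.sub ?_ ?_).congr fun n => (hsplit _ _).symm
    · have : Filter.Tendsto (fun n => y + (φ n).rOut) Filter.atTop (nhds y) := by
        simpa using hφ.const_add y
      exact (hF.tendsto y).comp this
    · have : Filter.Tendsto (fun n => x - (φ n).rOut) Filter.atTop (nhds x) := by
        simpa using hφ.const_sub x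
      exact (hF.tendsto x).comp this
  rw [abs_sub_comm]
  exact le_of_tendsto_of_tendsto' ((hconv x).sub (hconv y)).abs hlim
    fun n => h.abs_mollified_sub_le (φ n) hxy

theorem sq_integral_abs_le (h : IsH1 u u') {x y : ℝ} (hxy : x < y) :
    (∫ z in x..y, |u' z|) ^ 2 ≤ (y - x) * ∫ z in x..y, u' z ^ 2 := by
  set I := ∫ z in x..y, |u' z| with hI
  have i1 := h.intervalIntegrable_abs x y
  have i2 : IntervalIntegrable (fun z => u' z ^ 2) volume x y :=
    h.integrable_deriv_sq.intervalIntegrable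
  have hp : 0 < y - x := sub_pos.2 hxy
  -- integrate the square of the deviation of `|u'|` from its mean value
  have h1 : 0 ≤ ∫ z in x..y, (u' z ^ 2 - 2 * (I / (y - x)) * |u' z| + (I / (y - x)) ^ 2) :=
    intervalIntegral.integral_nonneg hxy.le fun z _ => by
      nlinarith [sq_nonneg (|u' z| - I / (y - x)), sq_abs (u' z)]
  rw [intervalIntegral.integral_add (i2.sub (i1.const_mul _)) intervalIntegrable_const,
    intervalIntegral.integral_sub i2 (i1.const_mul _), intervalIntegral.integral_const_mul,
    intervalIntegral.integral_const, ← hI, smul_eq_mul] at h1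
  have h2 := mul_nonneg hp.le h1
  have e : (y - x) * ((∫ z in x..y, u' z ^ 2) - 2 * (I / (y - x)) * I
      + (y - x) * (I / (y - x)) ^ 2) = (y - x) * (∫ z in x..y, u' z ^ 2) - I ^ 2 := by
    field_simp
    ring
  rw [e] at h2
  linarith

theorem sq_sub_le (h : IsH1 u u') {x y : ℝ} (hxy : x < y) :
    (u y - u x) ^ 2 ≤ (y - x) * ∫ z in x..y, u' z ^ 2 := by
  refine le_trans ?_ (h.sq_integral_abs_le hxy)
  rw [← sq_abs]
  gcongr
  exact h.abs_sub_le hxy.le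

end IsH1

theorem hasSum_integral_cells {g : ℝ → ℝ} (hg : Integrable g) {p : ℝ} (hp : 0 < p) (a : ℝ) :
    HasSum (fun j : ℤ => ∫ z in (a + j * p)..(a + (j + 1) * p), g z) (∫ z, g z) := by
  have h := hasSum_integral_iUnion (μ := volume) (f := g)
    (s := fun j : ℤ => Set.Ioc (a + j • p) (a + (j + 1) • p)) (fun _ => measurableSet_Ioc)
    (Set.pairwise_disjoint_Ioc_add_zsmul a p) hg.integrableOn
  rw [iUnion_Ioc_add_zsmul hp a, setIntegral_univ] at h
  refine h.congr_fun fun j => ?_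
  rw [intervalIntegral.integral_of_le (by nlinarith)]
  simp

theorem h1Norm_sq (u u' : ℝ → ℝ) : h1Norm u u' ^ 2 = (∫ x, u x ^ 2) + ∫ x, u' x ^ 2 :=
  Real.sq_sqrt (add_nonneg (integral_nonneg fun _ => sq_nonneg _)
    (integral_nonneg fun _ => sq_nonneg _))

/-- Sampling at the half-integer nodes gives a grid function of finite energy. -/
theorem energy_sample_le {u u' : ℝ → ℝ} (h : IsH1 u u') {dx : ℝ} (hdx : 0 < dx) (hdx1 : dx ≤ 1)
    {v : ℤ → ℝ} (hv : ∀ j : ℤ, v j = u (((j : ℝ) + 1 / 2) * dx)) :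
    (Summable fun j => v j ^ 2 + Dm dx v j ^ 2) ∧ energy dx v ≤ 3 * h1Norm u u' ^ 2 := by
  have c1 := hasSum_integral_cells h.integrable_sq hdx 0
  have c2 := hasSum_integral_cells h.integrable_deriv_sq hdx 0
  have c3 := hasSum_integral_cells h.integrable_deriv_sq hdx (-(dx / 2))
  have b1 : ∀ j : ℤ, dx * v j ^ 2 ≤ 2 * (∫ z in (0 + j * dx)..(0 + (j + 1) * dx), u z ^ 2)
      + 2 * dx ^ 2 * ∫ z in (0 + j * dx)..(0 + (j + 1) * dx), u' z ^ 2 := by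
    intro j
    set D := ∫ z in (0 + j * dx)..(0 + (j + 1) * dx), u' z ^ 2 with hD
    have hlt : 0 + (j : ℝ) * dx < 0 + ((j : ℝ) + 1) * dx := by nlinarith
    have hlen : 0 + ((j : ℝ) + 1) * dx - (0 + (j : ℝ) * dx) = dx := by ring
    have hpt : ∀ z ∈ Set.Icc (0 + (j : ℝ) * dx) (0 + ((j : ℝ) + 1) * dx),
        v j ^ 2 ≤ 2 * u z ^ 2 + 2 * (dx * D) := by
      intro z hz
      have hs : |v j - u z| ≤ ∫ z in (0 + j * dx)..(0 + (j + 1) * dx), |u' z| := by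
        have hsub : ∀ x y : ℝ, x ≤ y → 0 + (j : ℝ) * dx ≤ x → y ≤ 0 + ((j : ℝ) + 1) * dx →
            |u y - u x| ≤ ∫ z in (0 + j * dx)..(0 + (j + 1) * dx), |u' z| :=
          fun x y hxy hx hy => (h.abs_sub_le hxy).trans
            (intervalIntegral.integral_mono_interval hx hxy hy
              (ae_of_all _ fun _ => abs_nonneg _) (h.intervalIntegrable_abs _ _))
        rw [hv]
        rcases le_total z (((j : ℝ) + 1 / 2) * dx) with hle | hle
        · exact hsub _ _ hle hz.1 (by nlinarith)
        · rw [abs_sub_comm]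
          exact hsub _ _ hle (by nlinarith) hz.2
      have hs2 : (v j - u z) ^ 2 ≤ dx * D := by
        have := h.sq_integral_abs_le hlt
        rw [hlen] at this
        refine le_trans ?_ this
        rw [← sq_abs]
        gcongr
      nlinarith [sq_nonneg (v j - u z - u z)]
    have i1 : IntervalIntegrable (fun z => u z ^ 2) volume (0 + j * dx) (0 + (j + 1) * dx) :=
      h.integrable_sq.intervalIntegrable
    have := intervalIntegral.integral_mono_on hlt.le intervalIntegrable_const
      ((i1.const_mul 2).add intervalIntegrable_const) hpt
    rw [intervalIntegral.integral_add (i1.const_mul 2) intervalIntegrable_const,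
      intervalIntegral.integral_const, intervalIntegral.integral_const,
      intervalIntegral.integral_const_mul, hlen, smul_eq_mul, smul_eq_mul] at this
    linarith
  have b2 : ∀ j : ℤ, dx * Dm dx v j ^ 2
      ≤ ∫ z in (-(dx / 2) + j * dx)..(-(dx / 2) + (j + 1) * dx), u' z ^ 2 := by
    intro j
    have hlt : -(dx / 2) + (j : ℝ) * dx < -(dx / 2) + ((j : ℝ) + 1) * dx := by nlinarith
    have h1 := h.sq_sub_le hlt
    have e1 : v j = u (-(dx / 2) + ((j : ℝ) + 1) * dx) := by rw [hv]; congr 1; ring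
    have e2 : v (j - 1) = u (-(dx / 2) + (j : ℝ) * dx) := by
      rw [hv]; congr 1; push_cast; ring
    have hlen : -(dx / 2) + ((j : ℝ) + 1) * dx - (-(dx / 2) + (j : ℝ) * dx) = dx := by ring
    rw [← e1, ← e2, hlen] at h1
    rw [Dm, div_pow, sq dx]
    rw [show dx * ((v j - v (j - 1)) ^ 2 / (dx * dx)) = (v j - v (j - 1)) ^ 2 / dx by
      field_simp, div_le_iff₀ hdx]
    linarith
  have hs := ((c1.mul_left 2).add (c2.mul_left (2 * dx ^ 2))).add c3
  have hle := fun j => (mul_add dx (v j ^ 2) (Dm dx v j ^ 2)).le.trans (add_le_add (b1 j) (b2 j))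
  have hsum : Summable fun j => dx * (v j ^ 2 + Dm dx v j ^ 2) :=
    Summable.of_nonneg_of_le (fun j => by positivity) hle hs.summable
  refine ⟨(summable_mul_left_iff hdx.ne').1 hsum, ?_⟩
  rw [energy, ← tsum_mul_left]
  refine (hsum.tsum_le_tsum hle hs.summable).trans ?_
  rw [hs.tsum_eq, h1Norm_sq]
  have n1 : 0 ≤ ∫ x, u x ^ 2 := integral_nonneg fun _ => sq_nonneg _
  have n2 : 0 ≤ ∫ x, u' x ^ 2 := integral_nonneg fun _ => sq_nonneg _
  have : dx ^ 2 * (∫ x, u' x ^ 2) ≤ ∫ x, u' x ^ 2 :=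
    mul_le_of_le_one_left n2 (pow_le_one₀ hdx.le hdx1)
  linarith

/-! ### The renormalization `x (1 + x²)^(α/2)` -/

section Renormalization

variable {α : ℝ}

/-- A smooth substitute for `x |x|^α`. -/
noncomputable def renorm (α x : ℝ) : ℝ := x * (1 + x ^ 2) ^ (α / 2)

/-- The derivative of `renorm α`. -/
noncomputable def renormDeriv (α x : ℝ) : ℝ :=
  (1 + α) * (1 + x ^ 2) ^ (α / 2) - α * (1 + x ^ 2) ^ (α / 2 - 1)

theorem one_add_sq_pos (x : ℝ) : 0 < 1 + x ^ 2 := by positivity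

theorem one_add_sq_rpow_sub_one (α x : ℝ) :
    (1 + x ^ 2) ^ α = (1 + x ^ 2) * (1 + x ^ 2) ^ (α - 1) := by
  rw [Real.rpow_sub_one (one_add_sq_pos x).ne', mul_div_cancel₀ _ (one_add_sq_pos x).ne']

theorem hasDerivAt_one_add_sq_rpow (β x : ℝ) :
    HasDerivAt (fun x : ℝ => (1 + x ^ 2) ^ β) (2 * x * β * (1 + x ^ 2) ^ (β - 1)) x := by
  have h : HasDerivAt (fun x : ℝ => 1 + x ^ 2) (2 * x) x := by
    simpa using (hasDerivAt_pow 2 x).const_add 1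
  exact h.rpow_const (Or.inl (one_add_sq_pos x).ne')

theorem hasDerivAt_renorm (α x : ℝ) : HasDerivAt (renorm α) (renormDeriv α x) x := by
  have h := (hasDerivAt_id x).mul (hasDerivAt_one_add_sq_rpow (α / 2) x)
  refine h.congr_deriv ?_
  simp only [id, renormDeriv]
  rw [one_add_sq_rpow_sub_one (α / 2) x]
  ring

theorem hasDerivAt_renormDeriv (α x : ℝ) : HasDerivAt (renormDeriv α)
    ((1 + α) * (2 * x * (α / 2) * (1 + x ^ 2) ^ (α / 2 - 1))
      - α * (2 * x * (α / 2 - 1) * (1 + x ^ 2) ^ (α / 2 - 1 - 1))) x :=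
  ((hasDerivAt_one_add_sq_rpow (α / 2) x).const_mul _).sub
    ((hasDerivAt_one_add_sq_rpow (α / 2 - 1) x).const_mul _)

theorem abs_le_one_add_sq_rpow_half (x : ℝ) : |x| ≤ (1 + x ^ 2) ^ (1 / 2 : ℝ) := by
  rw [← Real.sqrt_eq_rpow, ← Real.sqrt_sq_eq_abs]
  exact Real.sqrt_le_sqrt (by linarith)

theorem isRenormalization_renorm (h0 : 0 < α) (h1 : α < 1) :
    IsRenormalization (renorm α) (renormDeriv α) 5 := by
  have ge_one : ∀ x : ℝ, 1 ≤ 1 + x ^ 2 := fun x => by linarith [sq_nonneg x]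
  have hmul : ∀ (x β : ℝ), β ≤ -(1 / 2) → |x| * (1 + x ^ 2) ^ β ≤ 1 := fun x β hβ => by
    calc |x| * (1 + x ^ 2) ^ β ≤ (1 + x ^ 2) ^ (1 / 2 : ℝ) * (1 + x ^ 2) ^ β := by
          gcongr; exact abs_le_one_add_sq_rpow_half x
      _ = (1 + x ^ 2) ^ (1 / 2 + β) := (Real.rpow_add (one_add_sq_pos x) _ _).symm
      _ ≤ 1 := Real.rpow_le_one_of_one_le_of_nonpos (ge_one x) (by linarith)
  have hbd : ∀ x, ‖deriv (renormDeriv α) x‖ ≤ 5 := fun x => by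
    rw [(hasDerivAt_renormDeriv α x).deriv, Real.norm_eq_abs]
    have a1 := hmul x (α / 2 - 1) (by linarith)
    have a2 := hmul x (α / 2 - 1 - 1) (by linarith)
    have b1 : |x * (1 + x ^ 2) ^ (α / 2 - 1)| ≤ 1 := by
      rwa [abs_mul, abs_of_pos (Real.rpow_pos_of_pos (one_add_sq_pos x) _)]
    have b2 : |x * (1 + x ^ 2) ^ (α / 2 - 1 - 1)| ≤ 1 := by
      rwa [abs_mul, abs_of_pos (Real.rpow_pos_of_pos (one_add_sq_pos x) _)]
    set A := x * (1 + x ^ 2) ^ (α / 2 - 1)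
    set B := x * (1 + x ^ 2) ^ (α / 2 - 1 - 1)
    have e : (1 + α) * (2 * x * (α / 2) * (1 + x ^ 2) ^ (α / 2 - 1))
        - α * (2 * x * (α / 2 - 1) * (1 + x ^ 2) ^ (α / 2 - 1 - 1))
        = (α * (1 + α)) * A + (α * (2 - α)) * B := by ring
    rw [e]
    have p1 : 0 ≤ α * (1 + α) := by positivity
    have p2 : 0 ≤ α * (2 - α) := mul_nonneg h0.le (by linarith)
    have c1 : |α * (1 + α) * A| ≤ α * (1 + α) * 1 := by
      rw [abs_mul, abs_of_nonneg p1]; gcongr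
    have c2 : |α * (2 - α) * B| ≤ α * (2 - α) * 1 := by
      rw [abs_mul, abs_of_nonneg p2]; gcongr
    have := abs_add_le (α * (1 + α) * A) (α * (2 - α) * B)
    nlinarith
  have hlip : ∀ a b, |renormDeriv α b - renormDeriv α a| ≤ 5 * |b - a| := fun a b =>
    Convex.norm_image_sub_le_of_norm_deriv_le (s := Set.univ)
      (fun x _ => (hasDerivAt_renormDeriv α x).differentiableAt) (fun x _ => hbd x)
      convex_univ (Set.mem_univ a) (Set.mem_univ b)
  refine ⟨by norm_num, fun a b => ?_, fun x => ?_, fun x => ?_⟩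
  · have hF : ∀ x, HasDerivAt (fun x => renorm α x - renormDeriv α a * x)
        (renormDeriv α x - renormDeriv α a) x := fun x =>
      ((hasDerivAt_renorm α x).sub ((hasDerivAt_id x).const_mul (renormDeriv α a))).congr_deriv
        (by rw [mul_one])
    have := Convex.norm_image_sub_le_of_norm_deriv_le (f := fun x => renorm α x
      - renormDeriv α a * x) (s := Set.uIcc a b) (C := 5 * |b - a|)
      (fun x _ => (hF x).differentiableAt) (fun x hx => by
        rw [(hF x).deriv, Real.norm_eq_abs]
        exact (hlip a x).trans (mul_le_mul_of_nonneg_left (Set.abs_sub_left_of_mem_uIcc hx)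
          (by norm_num))) (convex_uIcc a b) Set.left_mem_uIcc Set.right_mem_uIcc
    rw [Real.norm_eq_abs, Real.norm_eq_abs, mul_assoc, ← sq, sq_abs] at this
    refine le_trans (le_of_eq ?_) this
    congr 1
    ring
  · rw [renorm, abs_mul, abs_of_pos (Real.rpow_pos_of_pos (one_add_sq_pos x) _)]
    calc |x| * (1 + x ^ 2) ^ (α / 2)
        ≤ (1 + x ^ 2) ^ (1 / 2 : ℝ) * (1 + x ^ 2) ^ (1 / 2 : ℝ) := by
          refine mul_le_mul (abs_le_one_add_sq_rpow_half x)
            (Real.rpow_le_rpow_of_exponent_le (ge_one x) (by linarith)) (by positivity)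
            (by positivity)
      _ = 1 + x ^ 2 := by
        rw [← Real.rpow_add (one_add_sq_pos x), add_halves, Real.rpow_one]
  · have e1 : (1 + x ^ 2) ^ (α / 2) ≤ 1 + x ^ 2 := by
      simpa using Real.rpow_le_rpow_of_exponent_le (ge_one x) (by linarith : α / 2 ≤ 1)
    have e2 : (1 + x ^ 2) ^ (α / 2 - 1) ≤ (1 + x ^ 2) ^ (α / 2) :=
      Real.rpow_le_rpow_of_exponent_le (ge_one x) (by linarith)
    have e3 : 0 < (1 + x ^ 2) ^ (α / 2 - 1) := Real.rpow_pos_of_pos (one_add_sq_pos x) _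
    rw [renormDeriv, abs_le]
    constructor <;> nlinarith

/-- Coercivity; this is where `α < 1` enters. -/
theorem renorm_coercive (h0 : 0 < α) (h1 : α < 1) (x : ℝ) :
    (1 - α) / 2 * |x| ^ (2 + α) ≤ x * renorm α x - x ^ 2 * renormDeriv α x / 2 := by
  have e1 := one_add_sq_rpow_sub_one (α / 2) x
  have p : 0 < (1 + x ^ 2) ^ (α / 2 - 1) := Real.rpow_pos_of_pos (one_add_sq_pos x) _
  have h2 : |x| ^ (2 + α) ≤ x ^ 2 * (1 + x ^ 2) ^ (α / 2) := by
    rcases eq_or_ne x 0 with rfl | hx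
    · rw [abs_zero, Real.zero_rpow (by linarith)]; positivity
    · rw [Real.rpow_add (abs_pos.2 hx), Real.rpow_two, sq_abs]
      gcongr
      calc |x| ^ α = (|x| ^ (2 : ℝ)) ^ (α / 2) := by
            rw [← Real.rpow_mul (abs_nonneg x)]; congr 1; ring
        _ ≤ _ := by
          rw [Real.rpow_two, sq_abs]
          exact Real.rpow_le_rpow (sq_nonneg x) (by linarith) (by linarith)
  calc (1 - α) / 2 * |x| ^ (2 + α) ≤ (1 - α) / 2 * (x ^ 2 * (1 + x ^ 2) ^ (α / 2)) :=
        mul_le_mul_of_nonneg_left h2 (by linarith)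
    _ ≤ _ := by
      rw [renorm, renormDeriv, e1]
      have : 0 ≤ α * (x ^ 2 * (1 + x ^ 2) ^ (α / 2 - 1)) := by positivity
      linarith

end Renormalization

/-! ### Bounds along the scheme -/

namespace IsScheme

variable {u₀ u₀' : ℝ → ℝ} {dx dt : ℝ} {N : ℕ} {u P : ℕ → ℤ → ℝ}

theorem succ_eq (hs : IsScheme u₀ dx dt N u P) (hdt : 0 < dt) {n : ℕ} (hn : n < N) (j : ℤ) :
    u (n + 1) j = u n j + dt * velocity dx (u n) (P n) j := by
  have h := hs.step n hn j
  have h1 : Dt dt u n j = velocity dx (u n) (P n) j := by rw [velocity]; linarith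
  rw [← h1, Dt, mul_div_cancel₀ _ hdt.ne']
  ring

theorem dissipation_nonneg (hdt : 0 ≤ dt) (dx : ℝ) (u : ℕ → ℤ → ℝ) (n : ℕ) :
    0 ≤ ∑ i ∈ Finset.range n, dt * (dx ^ 2 * ∑' j, viscosity dx (u i) j) :=
  Finset.sum_nonneg fun _ _ => mul_nonneg hdt (mul_nonneg (sq_nonneg _)
    (tsum_nonneg fun _ => IsLevel.viscosity_nonneg _ _ _))

/-- Stability: the energy at time level `n` together with all the dissipation up to that level
stays bounded. With `A = 3 ‖u₀‖²` the hypothesis `hcfl` keeps the error of each Euler step below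
`κ A dt` as long as the energy is at most `2 A`, since `192 = 48 * 2 ^ 2`. -/
theorem isLevel_and_energy_le (hs : IsScheme u₀ dx dt N u P) (hu : IsH1 u₀ u₀') (hdx : 0 < dx)
    (hdx1 : dx ≤ 1) (hdt : 0 < dt) {κ A : ℝ} (hκ : 0 ≤ κ) (hκT : κ * (N * dt) ≤ 1)
    (hA : A = 3 * h1Norm u₀ u₀' ^ 2) (hcfl : 192 * A * (dt * (1 + 1 / dx ^ 2)) ≤ κ) :
    ∀ n ≤ N, IsLevel dx (u n) (P n) ∧ energy dx (u n)
      + ∑ i ∈ Finset.range n, dt * (dx ^ 2 * ∑' j, viscosity dx (u i) j)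
      ≤ A * (1 + n * dt * κ) := by
  have hA0 : 0 ≤ A := by rw [hA]; positivity
  intro n
  induction n with
  | zero =>
    intro h0
    obtain ⟨h1, h2⟩ := energy_sample_le hu hdx hdx1 hs.init
    refine ⟨⟨hdx, h1, hs.elliptic 0 h0, hs.bounded 0 h0⟩, ?_⟩
    simpa [hA] using h2
  | succ n ih =>
    intro hn
    obtain ⟨h1, h2⟩ := ih (by omega)
    have hstep := fun j => hs.succ_eq hdt (n := n) (by omega) j
    refine ⟨⟨hdx, h1.summable_add_velocity hstep, hs.elliptic _ hn, hs.bounded _ hn⟩, ?_⟩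
    have h3 := h1.energy_step hstep
    have hE0 := energy_nonneg hdx (u := u n)
    have hV := dissipation_nonneg hdt.le dx u n
    have hnN : (n : ℝ) * dt * κ ≤ 1 := by
      refine le_trans ?_ hκT
      rw [mul_comm κ]
      have : (n : ℝ) ≤ N := by exact_mod_cast (by omega : n ≤ N)
      gcongr
    have hE : energy dx (u n) ≤ 2 * A := by nlinarith
    have h4 : 48 * dt ^ 2 * (1 + 1 / dx ^ 2) * energy dx (u n) ^ 2 ≤ A * dt * κ := by
      calc _ ≤ 48 * dt ^ 2 * (1 + 1 / dx ^ 2) * (2 * A) ^ 2 := by gcongr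
        _ = A * dt * (192 * A * (dt * (1 + 1 / dx ^ 2))) := by ring
        _ ≤ _ := by gcongr
    rw [Finset.sum_range_succ]
    push_cast
    linarith

theorem energy_le_and_dissipation_le (hs : IsScheme u₀ dx dt N u P) (hu : IsH1 u₀ u₀')
    (hdx : 0 < dx) (hdx1 : dx ≤ 1) (hdt : 0 < dt) {κ A : ℝ} (hκ : 0 ≤ κ)
    (hκT : κ * (N * dt) ≤ 1) (hA : A = 3 * h1Norm u₀ u₀' ^ 2)
    (hcfl : 192 * A * (dt * (1 + 1 / dx ^ 2)) ≤ κ) {n : ℕ} (hn : n ≤ N) :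
    energy dx (u n) ≤ 2 * A ∧
      ∑ i ∈ Finset.range n, dt * (dx ^ 2 * ∑' j, viscosity dx (u i) j) ≤ 2 * A := by
  have hA0 : 0 ≤ A := by rw [hA]; positivity
  have h1 := (hs.isLevel_and_energy_le hu hdx hdx1 hdt hκ hκT hA hcfl n hn).2
  have h2 := dissipation_nonneg hdt.le dx u n
  have h3 := energy_nonneg hdx (u := u n)
  have h4 : (n : ℝ) * dt * κ ≤ 1 := by
    refine le_trans ?_ hκT
    rw [mul_comm κ]
    have : (n : ℝ) ≤ N := by exact_mod_cast hn
    gcongr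
  constructor <;> nlinarith

end IsScheme

/-- The trapezoidal cut-off equal to `1` on `|x| ≤ R - 1` and to `0` on `|x| ≥ R`. -/
noncomputable def cutoff (dx R : ℝ) (j : ℤ) : ℝ := max 0 (min 1 (R - |j * dx|))

theorem cutoff_nonneg (dx R : ℝ) (j : ℤ) : 0 ≤ cutoff dx R j := le_max_left _ _

theorem cutoff_le_one (dx R : ℝ) (j : ℤ) : cutoff dx R j ≤ 1 :=
  max_le zero_le_one (min_le_left _ _)

theorem cutoff_eq_zero {dx R : ℝ} {j : ℤ} (h : R ≤ |j * dx|) : cutoff dx R j = 0 :=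
  max_eq_left ((min_le_right _ _).trans (by linarith))

theorem abs_cutoff_sub_le (dx R : ℝ) (i j : ℤ) :
    |cutoff dx R i - cutoff dx R j| ≤ |i * dx - j * dx| := by
  unfold cutoff
  refine (abs_max_sub_max_le_max _ _ _ _).trans (max_le (by simp) ?_)
  refine (abs_min_sub_min_le_max _ _ _ _).trans (max_le (by simp) ?_)
  rw [sub_sub_sub_cancel_left, abs_sub_comm]
  exact abs_abs_sub_abs_le _ _

/-- The cut-off is dominated by the indicator of the nodes with `|x_j| ≤ R + 1`. -/
theorem isCutoff_cutoff {dx R : ℝ} (hdx : 0 < dx) (hdx1 : dx ≤ 1) (hR : 0 ≤ R) :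
    IsCutoff dx (cutoff dx R)
      (fun j => if j ∈ Finset.Icc (-⌊(R + 1) / dx⌋) ⌊(R + 1) / dx⌋ then 1 else 0) (2 * R + 3) := by
  set m := ⌊(R + 1) / dx⌋ with hm
  have hm0 : 0 ≤ m := Int.floor_nonneg.2 (by positivity)
  have hmem : ∀ j : ℤ, |j * dx| ≤ R + 1 → j ∈ Finset.Icc (-m) m := fun j hj => by
    rw [abs_mul, abs_of_pos hdx, ← le_div_iff₀ hdx] at hj
    rw [Finset.mem_Icc, ← abs_le, hm, Int.le_floor]
    exact_mod_cast hj
  have hzero : ∀ i j : ℤ, |i * dx - j * dx| ≤ 1 → j ∉ Finset.Icc (-m) m → cutoff dx R i = 0 := by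
    intro i j hij hj
    refine cutoff_eq_zero ?_
    have h1 : R + 1 < |j * dx| := lt_of_not_ge fun h => hj (hmem j h)
    have h2 := abs_sub_abs_le_abs_sub ((j : ℝ) * dx) (i * dx)
    rw [abs_sub_comm] at h2
    linarith
  have hself : ∀ j : ℤ, |(j : ℝ) * dx - j * dx| ≤ 1 := fun j => by simp
  have hdiff : ∀ i j : ℤ, |(i : ℝ) * dx - j * dx| = dx → |cutoff dx R i - cutoff dx R j|
      ≤ dx * (if j ∈ Finset.Icc (-m) m then 1 else 0) := by
    intro i j hij
    by_cases hj : j ∈ Finset.Icc (-m) m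
    · rw [if_pos hj, mul_one]
      exact (abs_cutoff_sub_le _ _ _ _).trans hij.le
    · rw [hzero i j (by linarith) hj, hzero j j (hself j) hj]
      simp [hj]
  refine ⟨cutoff_nonneg _ _, fun j => ?_, fun j => ?_, ?_, ?_, fun j => hdiff _ _ ?_,
    fun j => ?_⟩
  · by_cases hj : j ∈ Finset.Icc (-m) m
    · rw [if_pos hj]
      exact cutoff_le_one _ _ _
    · rw [if_neg hj, hzero j j (hself j) hj]
  · split_ifs <;> norm_num
  · exact summable_of_ne_finset_zero (s := Finset.Icc (-m) m) fun j hj => if_neg hj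
  · rw [tsum_eq_sum (s := Finset.Icc (-m) m) fun j hj => if_neg hj,
      Finset.sum_congr rfl fun j hj => if_pos hj, Finset.sum_const, Int.card_Icc, nsmul_eq_mul,
      mul_one]
    have h1 : (((m + 1 - -m).toNat : ℕ) : ℝ) = 2 * m + 1 := by
      have : (((m + 1 - -m).toNat : ℕ) : ℤ) = 2 * m + 1 := by omega
      exact_mod_cast this
    have h2 : (m : ℝ) * dx ≤ R + 1 := (le_div_iff₀ hdx).1 (Int.floor_le _)
    rw [h1]
    linarith
  · push_cast
    rw [add_mul, add_sub_cancel_left, one_mul, abs_of_pos hdx]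
  · rw [abs_sub_comm]
    refine hdiff _ _ ?_
    push_cast
    rw [sub_mul, sub_sub_cancel_left, one_mul, abs_neg, abs_of_pos hdx]

/-- The weighted sum of `|q|^(2+α)` at one time level. -/
noncomputable def levelSum (dx α : ℝ) (χ : ℤ → ℝ) (u : ℤ → ℝ) : ℝ :=
  dx * ∑' j, χ j * |Dm dx u j| ^ (2 + α)

section LevelSum

variable {dx α : ℝ} {u P χ η : ℤ → ℝ} {W : ℝ}

theorem levelSum_nonneg (hdx : 0 < dx) (hχ : ∀ j, 0 ≤ χ j) : 0 ≤ levelSum dx α χ u :=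
  mul_nonneg hdx.le (tsum_nonneg fun j => mul_nonneg (hχ j) (by positivity))

theorem IsLevel.sq_Dm_le_energy (h : IsLevel dx u P) (j : ℤ) :
    Dm dx u j ^ 2 ≤ energy dx u / dx := by
  rw [le_div_iff₀ h.pos, mul_comm, energy]
  refine mul_le_mul_of_nonneg_left ?_ h.pos.le
  exact le_trans (by linarith [sq_nonneg (u j)]) (h.summable.le_tsum j fun i _ => by positivity)

theorem IsLevel.abs_rpow_le (h : IsLevel dx u P) (h0 : 0 < α) (h1 : α < 1) (j : ℤ) :
    |Dm dx u j| ^ (2 + α) ≤ (2 + energy dx u / dx) * Dm dx u j ^ 2 := by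
  have h2 := h.sq_Dm_le_energy j
  set q := Dm dx u j
  rcases eq_or_ne q 0 with hq | hq
  · rw [hq, abs_zero, Real.zero_rpow (by linarith)]; simp
  · rw [Real.rpow_add (abs_pos.2 hq), Real.rpow_two, sq_abs, mul_comm]
    gcongr
    have h3 : |q| ^ α ≤ 1 + |q| := by
      rcases le_total |q| 1 with hle | hle
      · linarith [Real.rpow_le_one (abs_nonneg q) hle h0.le, abs_nonneg q]
      · have := Real.rpow_le_rpow_of_exponent_le hle h1.le
        rw [Real.rpow_one] at this
        linarith
    nlinarith [sq_nonneg (|q| - 1), sq_abs q]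

theorem IsLevel.summable_cutoff_mul_rpow (h : IsLevel dx u P) (hχ : IsCutoff dx χ η W)
    (h0 : 0 < α) (h1 : α < 1) : Summable fun j => χ j * |Dm dx u j| ^ (2 + α) := by
  refine summable_of_abs_le ((summable_sq_Dm h.summable).mul_left (2 + energy dx u / dx))
    fun j => ?_
  have hp : 0 ≤ |Dm dx u j| ^ (2 + α) := by positivity
  rw [abs_of_nonneg (mul_nonneg (hχ.nonneg j) hp)]
  exact (mul_le_of_le_one_left hp ((hχ.le j).trans (hχ.le_one j))).trans (h.abs_rpow_le h0 h1 j)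

theorem IsLevel.levelSum_le (h : IsLevel dx u P) (hχ : IsCutoff dx χ η W)
    (h0 : 0 < α) (h1 : α < 1) :
    levelSum dx α χ u ≤ (2 + energy dx u / dx) * energy dx u := by
  have hdx := h.pos
  have s1 := h.summable_cutoff_mul_rpow hχ h0 h1
  have s2 := (summable_sq_Dm h.summable).mul_left (2 + energy dx u / dx)
  have h2 := s1.tsum_le_tsum (fun j => (mul_le_of_le_one_left (by positivity)
    ((hχ.le j).trans (hχ.le_one j))).trans (h.abs_rpow_le h0 h1 j)) s2
  rw [tsum_mul_left] at h2
  have hE := energy_nonneg hdx (u := u)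
  have h3 : dx * ∑' j, Dm dx u j ^ 2 ≤ energy dx u := by
    have : 0 ≤ dx * ∑' j, u j ^ 2 := mul_nonneg hdx.le (tsum_nonneg fun _ => sq_nonneg _)
    linarith [energy_eq h.summable]
  calc levelSum dx α χ u ≤ dx * ((2 + energy dx u / dx) * ∑' j, Dm dx u j ^ 2) :=
        mul_le_mul_of_nonneg_left h2 hdx.le
    _ = (2 + energy dx u / dx) * (dx * ∑' j, Dm dx u j ^ 2) := by ring
    _ ≤ _ := by gcongr

end LevelSum

/-- The bound for the sum of `dt · levelSum` over all time levels. -/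
noncomputable def sumBound (A T α W : ℝ) : ℝ :=
  (2 * (W + 2 * A) + 15 * A + T * ((1 + 28 * A) * (W + 2 * A))) / ((1 - α) / 2)

namespace IsScheme

variable {u₀ u₀' : ℝ → ℝ} {dx dt : ℝ} {N : ℕ} {u P : ℕ → ℤ → ℝ}

/-- Summing the renormalized balance over the time levels. The Taylor remainders are paid for by
the dissipation and by the CFL condition. -/
theorem sum_levelSum_le (hs : IsScheme u₀ dx dt N u P) (hu : IsH1 u₀ u₀') (hdx : 0 < dx)
    (hdx1 : dx ≤ 1) (hdt : 0 < dt) {κ A : ℝ} (hκ : 0 ≤ κ) (hκT : κ * (N * dt) ≤ 1)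
    (hA : A = 3 * h1Norm u₀ u₀' ^ 2) (hcfl : 192 * A * (dt * (1 + 1 / dx ^ 2)) ≤ κ)
    {α : ℝ} (h0 : 0 < α) (h1 : α < 1) {χ η : ℤ → ℝ} {W : ℝ} (hχ : IsCutoff dx χ η W) :
    ∑ n ∈ Finset.range N, dt * levelSum dx α χ (u n) ≤ sumBound A (N * dt) α W := by
  have hA0 : 0 ≤ A := by rw [hA]; positivity
  have hlev := hs.isLevel_and_energy_le hu hdx hdx1 hdt hκ hκT hA hcfl
  have hE : ∀ n ≤ N, energy dx (u n) ≤ 2 * A := fun n hn =>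
    (hs.energy_le_and_dissipation_le hu hdx hdx1 hdt hκ hκT hA hcfl hn).1
  have hW : 0 ≤ W := (mul_nonneg hdx.le (tsum_nonneg fun j =>
    (hχ.nonneg j).trans (hχ.le j))).trans hχ.mass_le
  set Y : ℕ → ℝ := fun n => dx * ∑' j, χ j * renorm α (Dm dx (u n) j) with hY
  have hYbd : ∀ n ≤ N, |Y n| ≤ W + 2 * A := fun n hn =>
    ((hlev n hn).1.abs_tsum_cutoff_mul_le (isRenormalization_renorm h0 h1).abs_le hχ).trans
      (by linarith [hE n hn])
  have hstep : ∀ n ∈ Finset.range N, (1 - α) / 2 * (dt * levelSum dx α χ (u n))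
      ≤ (Y (n + 1) - Y n) + 5 * (dt * (dx ^ 2 * ∑' j, viscosity dx (u n) j))
        + dt * (5 * (κ * A) + (1 + 28 * A) * (W + 2 * A)) := by
    intro n hn
    have hn' := Finset.mem_range.1 hn
    have hl := (hlev n hn'.le).1
    have hEn := hE n hn'.le
    have hE0 := energy_nonneg hdx (u := u n)
    have h2 := hl.renorm_step (isRenormalization_renorm h0 h1) hχ hdt.le
      (fun j => hs.succ_eq hdt hn' j) (renorm_coercive h0 h1)
      (by simpa only [mul_left_comm] using
        (hl.summable_cutoff_mul_rpow hχ h0 h1).mul_left ((1 - α) / 2))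
    have h3 : dt ^ 2 * (dx * ∑' j, Dm dx (velocity dx (u n) (P n)) j ^ 2) ≤ dt * (κ * A) := by
      calc _ ≤ dt ^ 2 * (48 / dx ^ 2 * energy dx (u n) ^ 2) :=
            mul_le_mul_of_nonneg_left hl.tsum_sq_Dm_velocity_le (sq_nonneg _)
        _ ≤ dt ^ 2 * (48 / dx ^ 2 * (2 * A) ^ 2) := by gcongr
        _ = dt * (192 * A * (dt * (1 / dx ^ 2)) * A) := by ring
        _ ≤ dt * (192 * A * (dt * (1 + 1 / dx ^ 2)) * A) := by gcongr; linarith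
        _ ≤ _ := by gcongr
    have h4 : dt * (1 + 14 * energy dx (u n)) * (W + energy dx (u n))
        ≤ dt * (1 + 14 * (2 * A)) * (W + 2 * A) := by gcongr
    have h5 : dt * (dx * ∑' j, χ j * ((1 - α) / 2 * |Dm dx (u n) j| ^ (2 + α)))
        = (1 - α) / 2 * (dt * levelSum dx α χ (u n)) := by
      simp only [mul_left_comm (χ _)]
      rw [tsum_mul_left, levelSum]
      ring
    rw [h5] at h2
    simp only [hY]
    linarith
  have hsum := Finset.sum_le_sum hstep
  rw [← Finset.mul_sum _ _ ((1 - α) / 2), Finset.sum_add_distrib, Finset.sum_add_distrib,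
    Finset.sum_range_sub, Finset.sum_const, Finset.card_range, nsmul_eq_mul,
    ← Finset.mul_sum _ _ (5 : ℝ)] at hsum
  have hVN := (hs.energy_le_and_dissipation_le hu hdx hdx1 hdt hκ hκT hA hcfl le_rfl).2
  have hYN := abs_le.1 (hYbd N le_rfl)
  have hY0 := abs_le.1 (hYbd 0 (Nat.zero_le _))
  have hκA : κ * (N * dt) * A ≤ 1 * A := by gcongr
  rw [sumBound, le_div_iff₀ (by linarith), mul_comm]
  linarith

/-- The CFL condition makes up for the poor integrability at the last time level, which the
telescoping argument does not reach. -/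
theorem dt_mul_levelSum_le (hs : IsScheme u₀ dx dt N u P) (hu : IsH1 u₀ u₀') (hdx : 0 < dx)
    (hdx1 : dx ≤ 1) (hdt : 0 < dt) {κ A T : ℝ} (hκ : 0 ≤ κ) (hκ1 : κ ≤ 1) (hN : N * dt = T)
    (hT : 0 < T) (hκT : κ * (N * dt) ≤ 1)
    (hA : A = 3 * h1Norm u₀ u₀' ^ 2) (hcfl : 192 * A * (dt * (1 + 1 / dx ^ 2)) ≤ κ)
    {α : ℝ} (h0 : 0 < α) (h1 : α < 1) {χ η : ℤ → ℝ} {W : ℝ} (hχ : IsCutoff dx χ η W) :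
    dt * levelSum dx α χ (u N) ≤ 2 * A * (2 * T + 1) := by
  have hA0 : 0 ≤ A := by rw [hA]; positivity
  have hl := (hs.isLevel_and_energy_le hu hdx hdx1 hdt hκ hκT hA hcfl N le_rfl).1
  have hE2 := (hs.energy_le_and_dissipation_le hu hdx hdx1 hdt hκ hκT hA hcfl le_rfl).1
  have hE0 := energy_nonneg hdx (u := u N)
  have hdtT : dt ≤ T := by
    have hN1 : (1 : ℝ) ≤ N := by
      rcases Nat.eq_zero_or_pos N with h | h
      · rw [h] at hN; simp at hN; linarith
      · exact_mod_cast h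
    rw [← hN]
    exact le_mul_of_one_le_left hdt.le hN1
  have h2 : 2 * A * (dt / dx) ≤ 1 := by
    have h3 : 1 / dx ≤ 1 + 1 / dx ^ 2 := by
      rw [← one_div_pow]
      nlinarith [sq_nonneg (1 / dx - 1)]
    calc 2 * A * (dt / dx) ≤ 192 * A * (dt / dx) := by gcongr; norm_num
      _ = 192 * A * (dt * (1 / dx)) := by ring
      _ ≤ 192 * A * (dt * (1 + 1 / dx ^ 2)) := by gcongr
      _ ≤ 1 := hcfl.trans hκ1
  calc dt * levelSum dx α χ (u N)
      ≤ dt * ((2 + energy dx (u N) / dx) * energy dx (u N)) :=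
        mul_le_mul_of_nonneg_left (hl.levelSum_le hχ h0 h1) hdt.le
    _ ≤ dt * ((2 + 2 * A / dx) * (2 * A)) := by gcongr
    _ = 2 * A * (2 * dt + 2 * A * (dt / dx)) := by ring
    _ ≤ _ := by gcongr

end IsScheme
/-! ### The space-time integral of the interpolant -/

section Interpolant

variable {dx dt : ℝ} {u : ℕ → ℤ → ℝ} {r : ℝ}

theorem abs_rpow_qInterp_le (hdx : 0 < dx) (hdt : 0 < dt) (hr : 0 ≤ r) {n : ℕ} {j : ℤ} {t x : ℝ}
    (ht : t ∈ Set.Ico ((n : ℝ) * dt) (((n : ℝ) + 1) * dt))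
    (hx : x ∈ Set.Ico (((j : ℝ) - 1 / 2) * dx) (((j : ℝ) + 1 / 2) * dx)) :
    |qInterp dx dt u t x| ^ r ≤ |Dm dx (u n) j| ^ r + |Dm dx (u (n + 1)) j| ^ r := by
  have e : qInterp dx dt u t x = (1 - (t - n * dt) / dt) * Dm dx (u n) j
      + (t - n * dt) / dt * Dm dx (u (n + 1)) j := by
    rw [qInterp_eq hdx hdt u ht hx, q, Dt, q, q]
    field_simp
    ring
  set s := (t - n * dt) / dt with hs
  have s0 : 0 ≤ s := div_nonneg (by linarith [ht.1]) hdt.le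
  have s1 : s ≤ 1 := (div_le_one hdt).2 (by linarith [ht.2])
  set a := Dm dx (u n) j
  set b := Dm dx (u (n + 1)) j
  have h1 : |qInterp dx dt u t x| ≤ max |a| |b| := by
    rw [e]
    refine (abs_add_le _ _).trans ?_
    rw [abs_mul, abs_mul, abs_of_nonneg s0, abs_of_nonneg (sub_nonneg.2 s1)]
    nlinarith [le_max_left |a| |b|, le_max_right |a| |b|]
  refine (Real.rpow_le_rpow (abs_nonneg _) h1 hr).trans ?_
  have ha : 0 ≤ |a| ^ r := by positivity
  have hb : 0 ≤ |b| ^ r := by positivity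
  rcases max_choice |a| |b| with h | h <;> rw [h] <;> linarith

/-- If a function is bounded on each cell by the value of a grid function, its integral is
bounded by the corresponding sum. -/
theorem lintegral_le_of_le_on_cells (hdx : 0 < dx) {F : ℝ → ENNReal} {s : Set ℝ}
    (hs : MeasurableSet s) {h : ℤ → ℝ} (h0 : ∀ j, 0 ≤ h j) (hsum : Summable h)
    (hF : ∀ x ∈ s, ∀ j : ℤ, x ∈ Set.Ico (((j : ℝ) - 1 / 2) * dx) (((j : ℝ) + 1 / 2) * dx) →
      F x ≤ ENNReal.ofReal (h j)) :
    ∫⁻ x in s, F x ≤ ENNReal.ofReal (dx * ∑' j, h j) := by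
  set c : ℤ → Set ℝ := fun j =>
    Set.Ico (((j : ℝ) - 1 / 2) * dx) (((j : ℝ) + 1 / 2) * dx) ∩ s with hc
  have hcov : s ⊆ ⋃ j, c j := fun x hx => by
    refine Set.mem_iUnion.2 ⟨⌊x / dx + 1 / 2⌋, ⟨?_, ?_⟩, hx⟩
    · rw [← le_div_iff₀ hdx]
      linarith [Int.floor_le (x / dx + 1 / 2)]
    · rw [← div_lt_iff₀ hdx]
      linarith [Int.lt_floor_add_one (x / dx + 1 / 2)]
  calc ∫⁻ x in s, F x ≤ ∫⁻ x in ⋃ j, c j, F x := lintegral_mono_set hcov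
    _ ≤ ∑' j, ∫⁻ x in c j, F x := lintegral_iUnion_le _ _
    _ ≤ ∑' j, ENNReal.ofReal (dx * h j) := by
      refine ENNReal.tsum_le_tsum fun j => ?_
      calc ∫⁻ x in c j, F x ≤ ∫⁻ _ in c j, ENNReal.ofReal (h j) :=
            setLIntegral_mono' (measurableSet_Ico.inter hs) fun x hx => hF x hx.2 j hx.1
        _ = ENNReal.ofReal (h j) * volume (c j) := setLIntegral_const _ _
        _ ≤ ENNReal.ofReal (h j) * ENNReal.ofReal dx := by
          gcongr
          refine (measure_mono Set.inter_subset_left).trans (le_of_eq ?_)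
          rw [Real.volume_Ico]
          congr 1
          ring
        _ = ENNReal.ofReal (dx * h j) := by
          rw [← ENNReal.ofReal_mul (h0 j), mul_comm]
    _ = ENNReal.ofReal (dx * ∑' j, h j) := by
      rw [← tsum_mul_left, ENNReal.ofReal_tsum_of_nonneg (fun j => mul_nonneg hdx.le (h0 j))
        (hsum.mul_left dx)]

theorem lintegral_le_of_le_on_steps (hdt : 0 < dt) {N : ℕ} {T : ℝ} (hN : N * dt = T)
    {Φ : ℝ → ENNReal} {z : ℕ → ℝ} (hz : ∀ n, 0 ≤ z n)
    (hΦ : ∀ n < N, ∀ t ∈ Set.Ico ((n : ℝ) * dt) (((n : ℝ) + 1) * dt),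
      Φ t ≤ ENNReal.ofReal (z n)) :
    ∫⁻ t in Set.Icc 0 T, Φ t ≤ ENNReal.ofReal (∑ n ∈ Finset.range N, dt * z n) := by
  set c : Fin N → Set ℝ := fun n => Set.Ico (((n : ℕ) : ℝ) * dt) ((((n : ℕ) : ℝ) + 1) * dt)
  have hcov : Set.Ico 0 T ⊆ ⋃ n, c n := fun t ht => by
    have h0 : 0 ≤ t / dt := div_nonneg ht.1 hdt.le
    refine Set.mem_iUnion.2 ⟨⟨⌊t / dt⌋₊, ?_⟩, ?_, ?_⟩
    · rw [Nat.floor_lt h0, div_lt_iff₀ hdt, hN]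
      exact ht.2
    · rw [← le_div_iff₀ hdt]
      exact Nat.floor_le h0
    · rw [← div_lt_iff₀ hdt]
      exact Nat.lt_floor_add_one _
  rw [← setLIntegral_congr (Ico_ae_eq_Icc (μ := volume))]
  calc ∫⁻ t in Set.Ico 0 T, Φ t ≤ ∫⁻ t in ⋃ n, c n, Φ t := lintegral_mono_set hcov
    _ ≤ ∑' n, ∫⁻ t in c n, Φ t := lintegral_iUnion_le _ _
    _ ≤ ∑' n : Fin N, ENNReal.ofReal (dt * z n) := by
      refine ENNReal.tsum_le_tsum fun n => ?_
      calc ∫⁻ t in c n, Φ t ≤ ∫⁻ _ in c n, ENNReal.ofReal (z n) :=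
            setLIntegral_mono' measurableSet_Ico fun t ht => hΦ n n.2 t ht
        _ = ENNReal.ofReal (z n) * volume (c n) := setLIntegral_const _ _
        _ = ENNReal.ofReal (dt * z n) := by
          rw [Real.volume_Ico, ← ENNReal.ofReal_mul (hz n)]
          congr 1
          ring
    _ = ENNReal.ofReal (∑ n ∈ Finset.range N, dt * z n) := by
      rw [tsum_fintype, ENNReal.ofReal_sum_of_nonneg fun n _ => mul_nonneg hdt.le (hz n),
        Finset.sum_range]

end Interpolant

namespace IsScheme

variable {u₀ u₀' : ℝ → ℝ} {dx dt : ℝ} {N : ℕ} {u P : ℕ → ℤ → ℝ}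

/-- The higher integrability estimate, under a CFL condition stated in terms of `A` and `κ`. -/
theorem lintegral_qInterp_le (hs : IsScheme u₀ dx dt N u P) (hu : IsH1 u₀ u₀') (hdx : 0 < dx)
    (hdx1 : dx ≤ 1) (hdt : 0 < dt) {κ A T : ℝ} (hκ : 0 ≤ κ) (hκ1 : κ ≤ 1) (hN : N * dt = T)
    (hT : 0 < T) (hκT : κ * T ≤ 1)
    (hA : A = 3 * h1Norm u₀ u₀' ^ 2) (hcfl : 192 * A * (dt * (1 + 1 / dx ^ 2)) ≤ κ)
    {α : ℝ} (h0 : 0 < α) (h1 : α < 1) (a b : ℝ) :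
    ∫⁻ t in Set.Icc 0 T, ∫⁻ x in Set.Icc a b, ENNReal.ofReal (|qInterp dx dt u t x| ^ (2 + α))
      ≤ ENNReal.ofReal (2 * sumBound A T α (2 * (|a| + |b| + 2) + 3) + 2 * A * (2 * T + 1)) := by
  set R := |a| + |b| + 2 with hR
  have hκT' : κ * (N * dt) ≤ 1 := by rwa [hN]
  have hχ := isCutoff_cutoff (R := R) hdx hdx1 (by positivity)
  set χ := cutoff dx R
  have hlev := fun n hn =>
    (hs.isLevel_and_energy_le hu hdx hdx1 hdt hκ hκT' hA hcfl n hn).1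
  have hz : ∀ n, 0 ≤ levelSum dx α χ (u n) := fun n => levelSum_nonneg hdx hχ.nonneg
  have hχ1 : ∀ x ∈ Set.Icc a b, ∀ j : ℤ,
      x ∈ Set.Ico (((j : ℝ) - 1 / 2) * dx) (((j : ℝ) + 1 / 2) * dx) → χ j = 1 := by
    intro x hx j hj
    have hxa : |x| ≤ |a| + |b| := by
      have ha := abs_nonneg a
      have hb := abs_nonneg b
      exact abs_le.2 ⟨by linarith [hx.1, neg_abs_le a], by linarith [hx.2, le_abs_self b]⟩
    have hjx : |j * dx| ≤ R - 1 := by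
      have := abs_le.1 hxa
      exact abs_le.2 ⟨by linarith [hj.2], by linarith [hj.1]⟩
    have h2 : 1 ≤ R - |j * dx| := by linarith
    simp only [χ, cutoff]
    rw [min_eq_left h2, max_eq_right zero_le_one]
  have hmain := lintegral_le_of_le_on_steps hdt hN
    (Φ := fun t => ∫⁻ x in Set.Icc a b, ENNReal.ofReal (|qInterp dx dt u t x| ^ (2 + α)))
    (z := fun n => levelSum dx α χ (u n) + levelSum dx α χ (u (n + 1)))
    (fun n => add_nonneg (hz n) (hz (n + 1))) (fun n hn t ht => by
      have s1 := (hlev n hn.le).summable_cutoff_mul_rpow hχ h0 h1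
      have s2 := (hlev (n + 1) hn).summable_cutoff_mul_rpow hχ h0 h1
      have := lintegral_le_of_le_on_cells hdx (measurableSet_Icc (a := a) (b := b))
        (F := fun x => ENNReal.ofReal (|qInterp dx dt u t x| ^ (2 + α)))
        (h := fun j => χ j * |Dm dx (u n) j| ^ (2 + α) + χ j * |Dm dx (u (n + 1)) j| ^ (2 + α))
        (fun j => add_nonneg (mul_nonneg (hχ.nonneg j) (by positivity))
          (mul_nonneg (hχ.nonneg j) (by positivity))) (s1.add s2) (fun x hx j hj => by
            rw [hχ1 x hx j hj, one_mul, one_mul]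
            exact ENNReal.ofReal_le_ofReal
              (abs_rpow_qInterp_le hdx hdt (by linarith) ht hj))
      rw [s1.tsum_add s2, mul_add] at this
      exact this)
  refine hmain.trans (ENNReal.ofReal_le_ofReal ?_)
  have b1 := hs.sum_levelSum_le hu hdx hdx1 hdt hκ hκT' hA hcfl h0 h1 hχ
  have b2 := hs.dt_mul_levelSum_le hu hdx hdx1 hdt hκ hκ1 hN hT hκT' hA hcfl h0 h1 hχ
  rw [hN] at b1
  have e : ∑ n ∈ Finset.range N, dt * levelSum dx α χ (u (n + 1))
      = ∑ n ∈ Finset.range N, dt * levelSum dx α χ (u n)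
        + (dt * levelSum dx α χ (u N) - dt * levelSum dx α χ (u 0)) := by
    rw [← Finset.sum_range_sub (fun n => dt * levelSum dx α χ (u n)), ← Finset.sum_add_distrib]
    exact Finset.sum_congr rfl fun n _ => by ring
  simp only [mul_add dt]
  rw [Finset.sum_add_distrib, e]
  have := mul_nonneg hdt.le (hz 0)
  linarith

end IsScheme

end CamassaHolm

theorem mainTheorem4 :
    ∃ K : ℝ, 0 < K ∧
      ∀ (u₀ u₀' : ℝ → ℝ), CamassaHolm.IsH1 u₀ u₀' → u₀ ≠ 0 →
      ∀ T : ℝ, 0 < T →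
      ∃ δ : ℝ → ℝ, (∀ θ : ℝ, 0 < θ → 0 < δ θ) ∧
        ∀ a b α : ℝ, a < b → 0 < α → α < 1 →
        ∃ C : ℝ, ∀ θ : ℝ, α < θ →
        ∀ (dx dt : ℝ) (N : ℕ) (u P : ℕ → ℤ → ℝ),
          0 < dx → dx < δ θ → 0 < dt → (N : ℝ) * dt = T →
          CamassaHolm.CFL K θ (CamassaHolm.h1Norm u₀ u₀') dx dt →
          CamassaHolm.IsScheme u₀ dx dt N u P →
          ∫⁻ t in Set.Icc 0 T, ∫⁻ x in Set.Icc a b,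
              ENNReal.ofReal (|CamassaHolm.qInterp dx dt u t x| ^ (2 + α))
            ≤ ENNReal.ofReal C := by
  -- `576 = 3 * 192`: the factor `3` bounds the initial energy, `192` the error of the Euler steps.
  refine ⟨576, by norm_num, fun u₀ u₀' hu _ T hT => ?_⟩
  have hκ : 0 < min 1 (1 / T) := lt_min one_pos (by positivity)
  -- `dx < δ θ` amounts to `dx ^ θ < min 1 (1 / T)`; the logarithm in the CFL condition is then
  -- so small that the bound `3 ‖u₀‖²` for the energy at most doubles up to time `T`.
  refine ⟨fun θ => (min 1 (1 / T)) ^ (1 / θ), fun θ _ => Real.rpow_pos_of_pos hκ _,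
    fun a b α _ h0 h1 => ⟨2 * CamassaHolm.sumBound (3 * CamassaHolm.h1Norm u₀ u₀' ^ 2) T α
      (2 * (|a| + |b| + 2) + 3) + 2 * (3 * CamassaHolm.h1Norm u₀ u₀' ^ 2) * (2 * T + 1), fun θ hθ dx dt N u P hdx hδ hdt hN hcfl hs => ?_⟩⟩
  have hθ0 : 0 < θ := h0.trans hθ
  have hdx1 : dx ≤ 1 := hδ.le.trans (Real.rpow_le_one hκ.le (min_le_left _ _) (by positivity))
  have hpow : dx ^ θ ≤ min 1 (1 / T) := by
    calc dx ^ θ ≤ ((min 1 (1 / T)) ^ (1 / θ)) ^ θ := Real.rpow_le_rpow hdx.le hδ.le hθ0.le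
      _ = min 1 (1 / T) := by
        rw [← Real.rpow_mul hκ.le, one_div_mul_cancel hθ0.ne', Real.rpow_one]
  have hlog : Real.log (1 + dx ^ θ) ≤ min 1 (1 / T) := by
    have : 0 < 1 + dx ^ θ := by positivity
    linarith [Real.log_le_sub_one_of_pos this]
  refine hs.lintegral_qInterp_le hu hdx hdx1 hdt hκ.le (min_le_left _ _) hN hT ?_ rfl ?_ h0 h1 a b
  · calc min 1 (1 / T) * T ≤ 1 / T * T := by gcongr; exact min_le_right _ _
      _ = 1 := one_div_mul_cancel hT.ne'
  · rcases eq_or_ne (CamassaHolm.h1Norm u₀ u₀') 0 with hM | hM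
    · rw [hM]
      simpa using hT.le
    · rw [CamassaHolm.CFL, lt_div_iff₀ (by positivity)] at hcfl
      have h2 : 192 * (3 * CamassaHolm.h1Norm u₀ u₀' ^ 2) * (dt * (1 + 1 / dx ^ 2))
          = dt * (576 * CamassaHolm.h1Norm u₀ u₀' ^ 2 * (1 + dx ^ 2)) / dx ^ 2 := by
        field_simp
        ring
      rw [h2, div_le_iff₀ (by positivity)]
      exact hcfl.le.trans (by gcongr)
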